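/- **Setting.** Consider $x(t+1)=f(x(t),u(t),w(t))$ with $x\in\mathbb R^n$, $u\in\mathbb R^m$, $w(t)\in\mathbb W\subseteq\mathbb R^q$, the constraint $(x,u)\in\mathbb Z$, and a feedback $u=\pi(x,v)$. Put $f_\pi(x,v,w)=f(x,\pi(x,v),w)$, $\mathbb Z_\pi=\{(x,v):(x,\pi(x,v))\in\mathbb Z\}$, and for a set $\Omega\subseteq\mathbb R^n$ let $\bar{\mathbb Z}=\{(z,v):(z+\epsilon,v)\in\mathbb Z_\pi\ \forall\epsilon\in\Omega\}$. Let $L:\mathbb R^n\times\mathbb R^m\to\mathbb R$ be continuous, $L_\pi(x,v)=L(x,\pi(x,v))$ and $L^{\max}(z,v)=\max_{\epsilon\in\Omega}L_\pi(z+\epsilon,v)$. The stage cost $\ell$ is $L_\pi$ or $L^{\max}$. For an input sequence $v(\cdot)$ let $\phi(t,z,v)$ be the solution of the nominal system $z(t+1)=f_\pi(z(t),v(t),0)$, $z(0)=z$, and $J_T(z,v)=\sum_{t=0}^{T-1}\ell(\phi(t,z,v),v(t))$. Let $\mathbb X_f\subseteq\mathbb R^n$ and $V_f:\mathbb R^n\to\mathbb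 R$ be the terminal region and cost. For $N\ge1$, $V_N(z)$ is the minimum of $J_N(z,v)+V_f(\phi(N,z,v))$ over all $v$ with $(\phi(t,z,v),v(t))\in\bar{\mathbb Z}$ for $0\le t<N$ and $\phi(N,z,v)\in\mathbb X_f$; $\mathbb X_N$ is the set of $z$ for which such $v$ exist, and $v_N^*(\cdot;z)$ is a fixed minimizer. For $x\in\mathbb X_N\oplus\Omega$, $z_0^*(x)$ is a fixed minimizer of $V_N(z)$ over $z\in\mathbb X_N$ with $x\in\{z\}\oplus\Omega$. With the normalized stage cost $\bar\ell=\ell-\ell(z_s,v_s)$ (the point $(z_s,v_s)$ is introduced below), $V_\infty(z)$ is the infimum of $\limsup_{K\to\infty}\sum_{t=0}^{K-1}\bar\ell(\phi(t,z,v),v(t))$ over all $v$ with $(\phi(t,z,v),v(t))\in\bar{\mathbb Z}$ for all $t\ge0$. All these minima, and the infimum $V_\infty(z)$ whenever such $v$ exist, are assumed to be attained. A *nominal closed-loop sequence* of horizon $N$ is a sequence $\zeta$ with $\zeta(0)\in\mathbb X_N$ and $\zeta(t+1)\in\mathbb Z_{cl}(\zeta(t))$ for all $t$, where $\mathbb Z_{cl}(z)=\{z_0^*(x^+):x^+\in\{f_\pi(z,v_N^*(0;z),0)\}\oplus\Omega\}$.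 A *real closed-loop trajectory* of horizon $N$ is a sequence $x(\cdot)$ with $x(0)\in\mathbb X_N\oplus\Omega$ and $x(t+1)=f\big(x(t),\pi(x(t),v(0|t)),w(t)\big)$ for some disturbances $w(t)\in\mathbb W$, where $z(0|t)=z_0^*(x(t))$ and $v(0|t)=v_N^*(0;z(0|t))$. $\mathcal K$ is the class of continuous strictly increasing $\alpha:\mathbb R_{\ge0}\to\mathbb R_{\ge0}$ with $\alpha(0)=0$, $\mathcal K_\infty$ the unbounded ones, $\mathcal L$ the class of continuous strictly decreasing $\delta:\mathbb R_{\ge0}\to\mathbb R_{\ge0}$ with $\delta(t)\to0$ as $t\to\infty$, and $\mathcal{KL}$ the class of $\beta$ with $\beta(\cdot,t)\in\mathcal K$ for all $t\ge0$ and $\beta(r,\cdot)\in\mathcal L$ for all $r>0$. **Assumptions.** 1. $\mathbb Z,\mathbb W$ are compact and convex with nonempty interior, and $0\in\operatorname{int}\mathbb W$. 2. $\Omega$ is compact and robust control invariant: $x-z\in\Omega$, $(x,v)\in\mathbb Z_\pi$ and $w\in\mathbb W$ imply $f_\pi(x,v,w)-f_\pi(z,v,0)\in\Omega$. Both $\Omega$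 and $\bar{\mathbb Z}$ have nonempty interior, and $\bar{\mathbb Z}\subseteq\mathbb Z_\pi$ (which holds if $0\in\Omega$). 3. $\ell$ is Lipschitz continuous on $\mathbb Z_\pi$ with constant $\kappa_\ell>0$. 4. $(z_s,v_s)\in\operatorname{int}\bar{\mathbb Z}$ minimizes $\ell$ over the $(z,v)\in\bar{\mathbb Z}$ with $z=f_\pi(z,v,0)$, and is itself such a point. 5. $\mathbb X_f$ is closed, $z_s\in\operatorname{int}\mathbb X_f$, $V_f$ is continuous on $\mathbb X_f$, and there is $\kappa_f:\mathbb X_f\to\mathbb R^m$ such that for all $z\in\mathbb X_f$: $(z,\kappa_f(z))\in\bar{\mathbb Z}$, $f_\pi(z,\kappa_f(z),0)\in\mathbb X_f$ and $V_f(f_\pi(z,\kappa_f(z),0))-V_f(z)\le-\ell(z,\kappa_f(z))+\ell(z_s,v_s)$. 6. There are $\alpha_\ell\in\mathcal K_\infty$ and a bounded $\lambda:\mathbb R^n\to\mathbb R$ with $\lambda(f_\pi(z,v,0))-\lambda(z)\le\ell(z,v)-\ell(z_s,v_s)-\alpha_\ell(\|(z,v)-(z_s,v_s)\|)$ for all $(z,v)\in\bar{\mathbb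 Z}$, and, for all $N\ge1$, $z\in\mathbb X_N$ and $z_{cl}\in\mathbb Z_{cl}(z)$, the same bound with $v=v_N^*(0;z)$ holds for $\lambda(z_{cl})-\lambda(z)$. 7. (Exponential reachability) For all $N\ge1$ and $z\in\mathbb X_N$ there are an input sequence $v$ with $(\phi(t,z,v),v(t))\in\bar{\mathbb Z}$ for all $t\ge0$ and constants $c\ge0$, $\rho\in[0,1)$ such that $\|(\phi(t,z,v),v(t))-(z_s,v_s)\|\le c\rho^t$ for all $t\ge0$. 8. (Local $M$-step controllability) There is $M\in\mathbb N$ such that for every $\varepsilon>0$ there is $\delta>0$ such that any $y,y'$ in the closed $\delta$-ball around $z_s$ admit an input sequence $v$ with $\phi(M,y,v)=y'$ and $\|(\phi(k,y,v),v(k))-(z_s,v_s)\|\le\varepsilon$ for $0\le k<M$. 9. There is $\alpha_V\in\mathcal K_\infty$ with $|V_N(z)-V_N(z_s)|\le\alpha_V(\|z-z_s\|)$ for all $N\ge1$ and $z\in\mathbb X_N$. **Claim.** There is $\beta\in\mathcal{KL}$ such that $$\|\zeta(t)-z_s\|\le\beta(\|\zeta(0)-z_s\|,t)\qquad(\ast)$$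 for all $N\ge1$, all nominal closed-loop sequences $\zeta$ of horizon $N$ and all $t\in\mathbb N$. For $\beta\in\mathcal{KL}$ let $\mathbb U_\kappa^T(z)$ be the set of input sequences $v$ with $(\phi(t,z,v),v(t))\in\bar{\mathbb Z}$ for $0\le t<T$ and $\|\phi(T,z,v)-z_s\|\le\kappa:=\beta(\|z-z_s\|,T)$. Then for every $\beta\in\mathcal{KL}$ with $(\ast)$ there are $\delta_1,\delta_2\in\mathcal L$ such that for all $N\ge1$: (a) (nominal bounds) every nominal closed-loop sequence $\zeta$ of horizon $N$ satisfies, for all $T\in\mathbb N$, $$\sum_{t=0}^{T-1}\ell(\zeta(t),v_N^*(0;\zeta(t)))\le\inf_{v\in\mathbb U_\kappa^T(\zeta(0))}J_T(\zeta(0),v)+\delta_1(N)+\delta_2(T),$$ $$\limsup_{T\to\infty}\sum_{t=0}^{T-1}\bar\ell(\zeta(t),v_N^*(0;\zeta(t)))\le V_\infty(\zeta(0))+\delta_1(N);$$ (b) if $\ell=L^{\max}$, every real closed-loop trajectory $x$ of horizon $N$ satisfies the same bounds with the same $\delta_1,\delta_2$: for all $T\in\mathbb N$, $$\sum_{t=0}^{T-1}L_\pi(x(t),v(0|t))\le\inf_{v\in\mathbb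 U_\kappa^T(z(0|0))}J_T(z(0|0),v)+\delta_1(N)+\delta_2(T),$$ $$\limsup_{T\to\infty}\sum_{t=0}^{T-1}\big(L_\pi(x(t),v(0|t))-\ell(z_s,v_s)\big)\le V_\infty(z(0|0))+\delta_1(N);$$ (c) if $\ell=L_\pi$, every real closed-loop trajectory $x$ of horizon $N$ satisfies, for all $T\in\mathbb N$, $$\sum_{t=0}^{T-1}L_\pi(x(t),v(0|t))\le\inf_{v\in\mathbb U_\kappa^T(z(0|0))}J_T(z(0|0),v)+\delta_1(N)+\delta_2(T)+T\kappa_{L_\pi}\max_{\epsilon\in\Omega}\|\epsilon\|,$$ $$\sum_{t=0}^{T-1}\big(L_\pi(x(t),v(0|t))-\ell(z_s,v_s)\big)\le V_\infty(z(0|0))-V_\infty(z(0|T))+\delta_1(N)+T\kappa_{L_\pi}\max_{\epsilon\in\Omega}\|\epsilon\|.$$ -/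

import Mathlib

open Filter Topology
open scoped NNReal Pointwise

noncomputable section

/-- Euclidean space `ℝⁿ`. -/
abbrev Eu (n : ℕ) : Type := EuclideanSpace ℝ (Fin n)

/-! ### Comparison functions -/

/-- Class `𝒦`: continuous, strictly increasing, zero at zero. -/
def ClassK (α : ℝ≥0 → ℝ≥0) : Prop := Continuous α ∧ StrictMono α ∧ α 0 = 0

/-- Class `𝒦_∞`: unbounded class `𝒦` functions. -/
def ClassKInf (α : ℝ≥0 → ℝ≥0) : Prop := ClassK α ∧ ∀ b, ∃ a, b ≤ α a

/-- Class `ℒ`: continuous, strictly decreasing, tending to zero at infinity. -/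
def ClassL (δ : ℝ≥0 → ℝ≥0) : Prop := Continuous δ ∧ StrictAnti δ ∧ Tendsto δ atTop (𝓝 0)

/-- Class `𝒦ℒ`. The condition `β(r,·) ∈ ℒ` is imposed for `r > 0` only, since
`β(·,t) ∈ 𝒦` forces `β(0,t) = 0` for every `t`. -/
def ClassKL (β : ℝ≥0 → ℝ≥0 → ℝ≥0) : Prop :=
  (∀ t, ClassK fun r => β r t) ∧ ∀ r, 0 < r → ClassL (β r)

/-! ### The control problem -/

/-- The data of a tube-based economic MPC problem with terminal conditions. -/
structure TubeMPC (n m q : ℕ) where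
  /-- transition map `x⁺ = f(x,u,w)` -/
  f : Eu n → Eu m → Eu q → Eu n
  /-- parameterized feedback `u = π(x,v)` -/
  π : Eu n → Eu m → Eu m
  /-- state and input constraint set -/
  Z : Set (Eu n × Eu m)
  /-- disturbance set -/
  W : Set (Eu q)
  /-- cross section of the tube -/
  Ω : Set (Eu n)
  /-- stage cost of the real system -/
  L : Eu n → Eu m → ℝ
  /-- terminal region -/
  Xf : Set (Eu n)
  /-- terminal cost -/
  Vf : Eu n → ℝ
  /-- state component of the robust optimal steady state -/
  zs : Eu n
  /-- input component of the robust optimal steady state -/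
  vs : Eu m

namespace TubeMPC

variable {n m q : ℕ} (S : TubeMPC n m q)

/-- `f_π(x,v,w) = f(x,π(x,v),w)`. -/
def fπ (x : Eu n) (v : Eu m) (w : Eu q) : Eu n := S.f x (S.π x v) w

/-- `ℤ_π`: the pairs `(x,v)` with `(x,π(x,v)) ∈ ℤ`. -/
def Zπ : Set (Eu n × Eu m) := {p | (p.1, S.π p.1 p.2) ∈ S.Z}

/-- The tightened constraint set: `(z,v)` with `(z+ε,v) ∈ ℤ_π` for all `ε ∈ Ω`. -/
def Zbar : Set (Eu n × Eu m) := {p | ∀ ε ∈ S.Ω, (p.1 + ε, p.2) ∈ S.Zπ}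

/-- `Ω` is a robust control invariant set for the error dynamics under the feedback `π`. -/
def IsRCI : Prop :=
  IsCompact S.Ω ∧ ∀ x z : Eu n, ∀ v : Eu m, x - z ∈ S.Ω → (x, v) ∈ S.Zπ →
    ∀ w ∈ S.W, S.fπ x v w - S.fπ z v 0 ∈ S.Ω

/-- Nominal stage cost `L_π(x,v) = L(x,π(x,v))`. -/
def Lπ (x : Eu n) (v : Eu m) : ℝ := S.L x (S.π x v)

/-- Worst-case stage cost: the supremum of `L_π(z+ε,v)` over `ε ∈ Ω`. -/
def Lmax (z : Eu n) (v : Eu m) : ℝ := sSup ((fun ε => S.Lπ (z + ε) v) '' S.Ω)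

/-- The Euclidean distance of `(z,v)` to `(z',v')` in `ℝⁿ × ℝᵐ`. -/
def pairDist (z : Eu n) (v : Eu m) (z' : Eu n) (v' : Eu m) : ℝ≥0 :=
  ‖WithLp.toLp 2 (z - z', v - v')‖₊

/-- Solution `φ(t,z,v(·))` of the nominal system `z(t+1) = f_π(z(t),v(t),0)`, `z(0) = z`. -/
def traj (z : Eu n) (v : ℕ → Eu m) : ℕ → Eu n
  | 0 => z
  | t + 1 => S.fπ (traj z v t) (v t) 0

/-- `v` is an admissible input sequence of length `N` at `z`. -/
def Adm (N : ℕ) (z : Eu n) (v : ℕ → Eu m) : Prop :=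
  ∀ t < N, (S.traj z v t, v t) ∈ S.Zbar

/-- `v` is an admissible infinite input sequence at `z`. -/
def AdmInf (z : Eu n) (v : ℕ → Eu m) : Prop :=
  ∀ t, (S.traj z v t, v t) ∈ S.Zbar

/-- `v` is feasible at `z` for the horizon-`N` problem with terminal constraint. -/
def FeasN (N : ℕ) (z : Eu n) (v : ℕ → Eu m) : Prop :=
  S.Adm N z v ∧ S.traj z v N ∈ S.Xf

/-- `𝕏_N`: states at which the horizon-`N` problem with terminal constraint is feasible. -/
def XN (N : ℕ) : Set (Eu n) := {z | ∃ v, S.FeasN N z v}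

/-- `𝕏_∞`: states with an admissible infinite input sequence. -/
def XInf : Set (Eu n) := {z | ∃ v, S.AdmInf z v}

/-- The stage cost `ℓ - ℓ(z_s,v_s)`, normalized to vanish at the steady state. -/
def normalized (ℓ : Eu n → Eu m → ℝ) (z : Eu n) (v : Eu m) : ℝ := ℓ z v - ℓ S.zs S.vs

/-- `J_N(z,v(·))`. -/
def J (ℓ : Eu n → Eu m → ℝ) (N : ℕ) (z : Eu n) (v : ℕ → Eu m) : ℝ :=
  ∑ t ∈ Finset.range N, ℓ (S.traj z v t) (v t)

/-- Objective of the horizon-`N` problem with terminal cost. -/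
def Jf (ℓ : Eu n → Eu m → ℝ) (N : ℕ) (z : Eu n) (v : ℕ → Eu m) : ℝ :=
  S.J ℓ N z v + S.Vf (S.traj z v N)

/-- Optimal value `V_N(z)` of the problem with terminal conditions. It is used only at `z ∈ 𝕏_N`,
where the minimum is attained. -/
def V (ℓ : Eu n → Eu m → ℝ) (N : ℕ) (z : Eu n) : ℝ :=
  sInf (S.Jf ℓ N z '' {v | S.FeasN N z v})

/-- `J_∞(z,v(·)) = limsup_{N → ∞} J_N(z,v(·))`, an extended real number. -/
def JInf (ℓ : Eu n → Eu m → ℝ) (z : Eu n) (v : ℕ → Eu m) : EReal :=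
  limsup (fun N => (S.J ℓ N z v : EReal)) atTop

/-- `V_∞(z)`: the infimum of `J_∞(z,·)` over the admissible infinite input sequences. -/
def VInf (ℓ : Eu n → Eu m → ℝ) (z : Eu n) : EReal :=
  ⨅ v ∈ {v | S.AdmInf z v}, S.JInf ℓ z v

/-- The admissible input sequences of length `T` steering `z` into the closed `κ`-ball
around `z_s` at time `T`. -/
def UBall (κ : ℝ≥0) (T : ℕ) (z : Eu n) : Set (ℕ → Eu m) :=
  {v | S.Adm T z v ∧ ‖S.traj z v T - S.zs‖ ≤ κ}

/-! ### Minimizers and closed loop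

`vN N z` is the minimizer `v_N^*(·;z)` of the horizon-`N` problem, and `z0 N x` is the minimizing
initial nominal state `z_0^*(x)` at the real state `x`. -/

/-- `vN N z` minimizes the horizon-`N` problem at every feasible `z`. -/
def IsInputMinimizer (ℓ : Eu n → Eu m → ℝ) (vN : ℕ → Eu n → ℕ → Eu m) : Prop :=
  ∀ N, 1 ≤ N → ∀ z ∈ S.XN N, S.FeasN N z (vN N z) ∧
    ∀ v, S.FeasN N z v → S.Jf ℓ N z (vN N z) ≤ S.Jf ℓ N z v

/-- `z0 N x` minimizes `V_N(z)` over all (feasible) `z` with `x ∈ {z} ⊕ Ω`. -/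
def IsStateMinimizer (ℓ : Eu n → Eu m → ℝ) (z0 : ℕ → Eu n → Eu n) : Prop :=
  ∀ N, 1 ≤ N → ∀ x ∈ S.XN N + S.Ω, (z0 N x ∈ S.XN N ∧ x ∈ {z0 N x} + S.Ω) ∧
    ∀ z ∈ S.XN N, x ∈ {z} + S.Ω → S.V ℓ N (z0 N x) ≤ S.V ℓ N z

/-- The set of possible next nominal states, given the current nominal state `z`. -/
def Zcl (vN : ℕ → Eu n → ℕ → Eu m) (z0 : ℕ → Eu n → Eu n) (N : ℕ) (z : Eu n) : Set (Eu n) :=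
  z0 N '' ({S.fπ z (vN N z 0) 0} + S.Ω)

/-- `ζ t = z_N^*(0|t)` is a closed-loop nominal sequence of the horizon-`N` scheme. -/
def IsNominalClosedLoop (vN : ℕ → Eu n → ℕ → Eu m) (z0 : ℕ → Eu n → Eu n) (N : ℕ)
    (ζ : ℕ → Eu n) : Prop :=
  ζ 0 ∈ S.XN N ∧ ∀ t, ζ (t + 1) ∈ S.Zcl vN z0 N (ζ t)

/-- `x` is a real closed-loop state trajectory: at time `t` the input `π(x(t),v_N^*(0|t))` is
applied, where `v_N^*(0|t) = v_N^*(0;z_0^*(x(t)))`, and an arbitrary disturbance acts. -/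
def IsRealClosedLoop (vN : ℕ → Eu n → ℕ → Eu m) (z0 : ℕ → Eu n → Eu n) (N : ℕ)
    (x : ℕ → Eu n) : Prop :=
  x 0 ∈ S.XN N + S.Ω ∧ ∃ w : ℕ → Eu q, (∀ t, w t ∈ S.W) ∧
    ∀ t, x (t + 1) = S.f (x t) (S.π (x t) (vN N (z0 N (x t)) 0)) (w t)

/-- Closed-loop cost up to time `T` of a nominal sequence `ζ`. -/
def nomCost (ℓ : Eu n → Eu m → ℝ) (vN : ℕ → Eu n → ℕ → Eu m) (N : ℕ) (ζ : ℕ → Eu n)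
    (T : ℕ) : ℝ :=
  ∑ t ∈ Finset.range T, ℓ (ζ t) (vN N (ζ t) 0)

/-- Closed-loop cost up to time `T` of a real trajectory `x`, for a cost `c` of the real
state and the artificial input `v_N^*(0|t)`. -/
def realCost (c : Eu n → Eu m → ℝ) (vN : ℕ → Eu n → ℕ → Eu m) (z0 : ℕ → Eu n → Eu n) (N : ℕ)
    (x : ℕ → Eu n) (T : ℕ) : ℝ :=
  ∑ t ∈ Finset.range T, c (x t) (vN N (z0 N (x t)) 0)

/-! ### Assumptions -/

/-- Closedness, invariance and decrease conditions on the terminal region and cost. -/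
def TerminalAssumption (ℓ : Eu n → Eu m → ℝ) : Prop :=
  IsClosed S.Xf ∧ S.zs ∈ interior S.Xf ∧ ContinuousOn S.Vf S.Xf ∧
  ∃ κf : Eu n → Eu m, ∀ z ∈ S.Xf,
    (z, κf z) ∈ S.Zbar ∧ S.fπ z (κf z) 0 ∈ S.Xf ∧
    S.Vf (S.fπ z (κf z) 0) - S.Vf z ≤ -ℓ z (κf z) + ℓ S.zs S.vs

/-- Strict dissipativity of the nominal system on the tightened constraint set, and, with the same
storage function, the dissipation inequality along the closed-loop nominal sequences. -/
def StrongDissipativity (ℓ : Eu n → Eu m → ℝ) (vN : ℕ → Eu n → ℕ → Eu m)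
    (z0 : ℕ → Eu n → Eu n) : Prop :=
  ∃ (α : ℝ≥0 → ℝ≥0) (lam : Eu n → ℝ), ClassKInf α ∧ (∃ C, ∀ z, |lam z| ≤ C) ∧
    (∀ z v, (z, v) ∈ S.Zbar →
      lam (S.fπ z v 0) - lam z ≤ ℓ z v - ℓ S.zs S.vs - α (pairDist z v S.zs S.vs)) ∧
    (∀ N, 1 ≤ N → ∀ z ∈ S.XN N, ∀ zcl ∈ S.Zcl vN z0 N z,
      lam zcl - lam z ≤
        ℓ z (vN N z 0) - ℓ S.zs S.vs - α (pairDist z (vN N z 0) S.zs S.vs))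

/-- Exponential reachability of the steady state from the feasible states. -/
def ExpReachable : Prop :=
  ∀ N, 1 ≤ N → ∀ z ∈ S.XN N, ∃ v, S.AdmInf z v ∧ ∃ c ρ : ℝ, 0 ≤ c ∧ 0 ≤ ρ ∧ ρ < 1 ∧
    ∀ k, (pairDist (S.traj z v k) (v k) S.zs S.vs : ℝ) ≤ c * ρ ^ k

/-- Local `M`-step controllability at the steady state, for some `M`: any two states close
to `z_s` are connected in `M` steps by a trajectory and inputs close to `(z_s,v_s)`. -/
def LocallyControllable : Prop :=
  ∃ M : ℕ, ∀ ε : ℝ, 0 < ε → ∃ δ : ℝ, 0 < δ ∧ ∀ y y' : Eu n,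
    ‖y - S.zs‖ ≤ δ → ‖y' - S.zs‖ ≤ δ → ∃ v : ℕ → Eu m, S.traj y v M = y' ∧
      ∀ k < M, (pairDist (S.traj y v k) (v k) S.zs S.vs : ℝ) ≤ ε

/-- The optimal value functions are continuous at the steady state, uniformly in `N`. -/
def ValueContinuity (ℓ : Eu n → Eu m → ℝ) : Prop :=
  ∃ α : ℝ≥0 → ℝ≥0, ClassKInf α ∧ ∀ N, 1 ≤ N → ∀ z ∈ S.XN N,
    |S.V ℓ N z - S.V ℓ N S.zs| ≤ α ‖z - S.zs‖₊

/-- The standing assumptions, for the stage cost `ℓ` with Lipschitz constant `κ`. -/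
structure Standing (ℓ : Eu n → Eu m → ℝ) (κ : ℝ) (vN : ℕ → Eu n → ℕ → Eu m)
    (z0 : ℕ → Eu n → Eu n) : Prop where
  Z_compact : IsCompact S.Z
  Z_convex : Convex ℝ S.Z
  Z_interior : (interior S.Z).Nonempty
  W_compact : IsCompact S.W
  W_convex : Convex ℝ S.W
  W_zero : (0 : Eu q) ∈ interior S.W
  rci : S.IsRCI
  Ω_interior : (interior S.Ω).Nonempty
  Zbar_interior : (interior S.Zbar).Nonempty
  /-- The stage cost, a function on `ℤ_π`, is defined at all nominal pairs (true if `0 ∈ Ω`). -/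
  Zbar_subset : S.Zbar ⊆ S.Zπ
  L_cont : Continuous fun p : Eu n × Eu m => S.L p.1 p.2
  κ_pos : 0 < κ
  lipschitz : ∀ p ∈ S.Zπ, ∀ p' ∈ S.Zπ,
    |ℓ p.1 p.2 - ℓ p'.1 p'.2| ≤ κ * (pairDist p.1 p.2 p'.1 p'.2 : ℝ)
  terminal : S.TerminalAssumption ℓ
  /-- `(z_s,v_s)` is a steady state of the nominal system. -/
  steady : S.fπ S.zs S.vs 0 = S.zs
  /-- It minimizes the stage cost among the steady states in the tightened constraint set. -/
  steady_opt : ∀ z v, (z, v) ∈ S.Zbar → S.fπ z v 0 = z → ℓ S.zs S.vs ≤ ℓ z v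
  steady_interior : (S.zs, S.vs) ∈ interior S.Zbar
  dissipativity : S.StrongDissipativity ℓ vN z0
  reachable : S.ExpReachable
  controllable : S.LocallyControllable
  value_cont : S.ValueContinuity ℓ
  /-- Existence of optimal sequences on finite horizons and of the optimal nominal state. -/
  input_min : S.IsInputMinimizer ℓ vN
  state_min : S.IsStateMinimizer ℓ z0
  /-- Existence of optimal sequences on the infinite horizon. -/
  infinite_min : ∀ z ∈ S.XInf, ∃ v, S.AdmInf z v ∧
    S.JInf (S.normalized ℓ) z v = S.VInf (S.normalized ℓ) z

/-! ### The nominal results that are carried over -/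

/-- `β` bounds the distance to `z_s` of every closed-loop nominal sequence of every horizon. -/
def ConvergenceBound (vN : ℕ → Eu n → ℕ → Eu m) (z0 : ℕ → Eu n → Eu n)
    (β : ℝ≥0 → ℝ≥0 → ℝ≥0) : Prop :=
  ∀ N, 1 ≤ N → ∀ ζ, S.IsNominalClosedLoop vN z0 N ζ →
    ∀ t : ℕ, ‖ζ t - S.zs‖₊ ≤ β ‖ζ 0 - S.zs‖₊ t

/-- The radius `κ = β(‖z - z_s‖,T)`. -/
def radius (β : ℝ≥0 → ℝ≥0 → ℝ≥0) (z : Eu n) (T : ℕ) : ℝ≥0 := β ‖z - S.zs‖₊ T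

/-- The infimum of `J_T(z,v(·))` over the admissible sequences steering `z` into the ball of
radius `κ = β(‖z - z_s‖,T)` (it is `+∞` if there are none). -/
def bestTransient (ℓ : Eu n → Eu m → ℝ) (β : ℝ≥0 → ℝ≥0 → ℝ≥0) (T : ℕ) (z : Eu n) : EReal :=
  ⨅ v ∈ S.UBall (S.radius β z T) T z, (S.J ℓ T z v : EReal)

/-- The transient and the non-averaged bounds, with error terms `δ₁` and `δ₂`, for the closed-loop
nominal sequences. -/
def NominalBounds (ℓ : Eu n → Eu m → ℝ) (vN : ℕ → Eu n → ℕ → Eu m) (z0 : ℕ → Eu n → Eu n)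
    (β : ℝ≥0 → ℝ≥0 → ℝ≥0) (δ₁ δ₂ : ℝ≥0 → ℝ≥0) : Prop :=
  ∀ N : ℕ, 1 ≤ N → ∀ ζ, S.IsNominalClosedLoop vN z0 N ζ →
    (∀ T : ℕ, (nomCost ℓ vN N ζ T : EReal) ≤
      S.bestTransient ℓ β T (ζ 0) + (δ₁ N : ℝ) + (δ₂ T : ℝ)) ∧
    limsup (fun T => (nomCost (S.normalized ℓ) vN N ζ T : EReal)) atTop ≤
      S.VInf (S.normalized ℓ) (ζ 0) + (δ₁ N : ℝ)

end TubeMPC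

end

noncomputable section

/-! ### Comparison functions: inverses, majorants and Lyapunov bounds -/

/-! Everything rests on comparing costs with D_N(z) = V_N(z) - V_N(z_s), where stage costs are
normalized to vanish at the steady state.

From above: shifting an optimal sequence and appending the terminal feedback makes V_N drop by at
least the stage cost in each closed-loop step. Re-optimizing the nominal state cannot spoil this,
because the shifted state remains a candidate (`zcl_mem_and_V_le`). Telescoping bounds the
closed-loop cost by V_N(ζ(0)) - V_N(ζ(T)), and ζ(T) is near z_s.

From below: no admissible sequence of any length T costs less than D_N(z), up to δ(N) + ω(distance
of its end point to z_s) (`exists_value_le_J_add_turnpike`). A cheaper sequence has bounded total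
dissipation, so if T > N it passes close to z_s at some time P < N. Up to P it cannot beat V_N by
much, since the terminal feedback would complete it to a feasible sequence. After P the gain is
limited by differences of the storage function, which local controllability makes continuous at z_s.

Letting T tend to infinity gives V_∞ ≤ D_N ≤ V_∞ + δ(N) on 𝕏_N, hence the infinite-horizon bounds.
The convergence bound holds because V_N plus the storage function is a Lyapunov function with
estimates independent of N. For the real system, invariance of Ω makes the selected nominal states a
nominal closed-loop sequence, and only the cost difference within the tube remains to be estimated.
-/

theorem ClassKInf.surjective {α : ℝ≥0 → ℝ≥0} (h : ClassKInf α) : Function.Surjective α := by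
  intro b
  obtain ⟨a, ha⟩ := h.2 b
  have := intermediate_value_Icc (a := 0) (b := a) zero_le h.1.1.continuousOn
  obtain ⟨c, -, hc⟩ := this ⟨by simp [h.1.2.2], ha⟩
  exact ⟨c, hc⟩

/-- The inverse of a class `𝒦_∞` function. -/
theorem ClassKInf.exists_inverse {α : ℝ≥0 → ℝ≥0} (h : ClassKInf α) :
    ∃ γ : ℝ≥0 → ℝ≥0, ClassK γ ∧ ∀ r s, α r ≤ s ↔ r ≤ γ s := by
  let e := h.1.2.1.orderIsoOfSurjective α h.surjective
  have he : ∀ r, e r = α r := fun r => rfl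
  refine ⟨e.symm, ⟨e.symm.continuous, e.symm.strictMono, ?_⟩, fun r s => ?_⟩
  · rw [OrderIso.symm_apply_eq, he, h.1.2.2]
  · rw [← he, OrderIso.le_symm_apply]

theorem ClassK.comp {α γ : ℝ≥0 → ℝ≥0} (hα : ClassK α) (hγ : ClassK γ) :
    ClassK fun r => α (γ r) :=
  ⟨hα.1.comp hγ.1, hα.2.1.comp hγ.2.1, by simp [hα.2.2, hγ.2.2]⟩

theorem ClassK.comp_classL {α δ : ℝ≥0 → ℝ≥0} (hα : ClassK α) (hδ : ClassL δ) :
    ClassL fun t => α (δ t) := by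
  refine ⟨hα.1.comp hδ.1, hα.2.1.comp_strictAnti hδ.2.1, ?_⟩
  have := (hα.1.tendsto 0).comp hδ.2.2
  rwa [hα.2.2] at this

theorem ClassL.add {δ δ' : ℝ≥0 → ℝ≥0} (h : ClassL δ) (h' : ClassL δ') :
    ClassL fun t => δ t + δ' t :=
  ⟨h.1.add h'.1, h.2.1.add h'.2.1, by simpa using h.2.2.add h'.2.2⟩

theorem classL_div_add_one {c : ℝ≥0} (hc : 0 < c) : ClassL fun t => c / (t + 1) := by
  refine ⟨?_, ?_, ?_⟩
  · exact continuous_const.div (continuous_id.add continuous_const) fun t => by positivity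
  · intro a b hab
    exact div_lt_div_of_pos_left hc (by positivity) (by gcongr)
  · have h1 : Tendsto (fun t : ℝ≥0 => (t : ℝ) + 1) atTop atTop :=
      tendsto_atTop_add_const_right _ _ (NNReal.tendsto_coe_atTop.2 tendsto_id)
    rw [← NNReal.tendsto_coe]
    push_cast
    exact tendsto_const_nhds.div_atTop h1

/-- Bounded quantities `g i` that are small where `r i` is small are bounded by a class `𝒦_∞`
function of `r i`. -/
theorem exists_classKInf_majorant {ι : Type*} (r : ι → ℝ≥0) (g : ι → ℝ) (B : ℝ)
    (hB : ∀ i, g i ≤ B) (h0 : ∀ ε : ℝ, 0 < ε → ∃ δ : ℝ≥0, 0 < δ ∧ ∀ i, r i ≤ δ → g i ≤ ε) :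
    ∃ ω, ClassKInf ω ∧ ∀ i, g i ≤ ω (r i) := by
  wlog hpos : 0 < B generalizing B
  · exact this (max B 1) (fun i => (hB i).trans (le_max_left _ _)) (by positivity)
  choose d hd0 hd using fun k : ℕ => h0 (B * (1 / 2) ^ k) (by positivity)
  -- The k-th ramp reaches its full height B/2^k at `d (k + 1)`. If k + 1 is the first index with
  -- B/2^(k+1) < `g i`, then `r i` exceeds `d (k + 1)`, so this single ramp already dominates `g i`.
  let F : ℕ → ℝ≥0 → ℝ := fun k s => B * (1 / 2) ^ k * min 1 (s / d (k + 1) : ℝ)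
  have hF0 : ∀ k s, 0 ≤ F k s := fun k s => by positivity
  have hFB : ∀ k s, F k s ≤ B * (1 / 2) ^ k := fun k s =>
    mul_le_of_le_one_right (by positivity) (min_le_left _ _)
  have hgeom : Summable fun k : ℕ => B * (1 / 2 : ℝ) ^ k :=
    summable_geometric_two.mul_left B
  have hsum : ∀ s, Summable fun k => F k s := fun s =>
    Summable.of_nonneg_of_le (fun k => hF0 k s) (fun k => hFB k s) hgeom
  have hcont : Continuous fun s => ∑' k, F k s := by
    refine continuous_tsum (fun k => ?_) hgeom fun k s => ?_
    · have := (hd0 (k + 1)).ne'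
      fun_prop (disch := simpa using this)
    · rw [Real.norm_of_nonneg (hF0 k s)]
      exact hFB k s
  have hmono : Monotone fun s => ∑' k, F k s := by
    intro s s' hs
    refine Summable.tsum_le_tsum (fun k => ?_) (hsum s) (hsum s')
    have : (s : ℝ) ≤ s' := hs
    simp only [F]
    gcongr
  have hnonneg : ∀ s, 0 ≤ ∑' k, F k s := fun s => tsum_nonneg fun k => hF0 k s
  -- The sum of ramps is bounded and only monotone; the summand `s` supplies strict monotonicity and
  -- unboundedness.
  refine ⟨fun s => s + (∑' k, F k s).toNNReal, ⟨⟨?_, ?_, ?_⟩, fun b => ⟨b, by simp⟩⟩, fun i => ?_⟩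
  · exact continuous_id.add (continuous_real_toNNReal.comp hcont)
  · exact strictMono_id.add_monotone fun s s' hs => Real.toNNReal_le_toNNReal (hmono hs)
  · simp [F]
  · rw [NNReal.coe_add, Real.coe_toNNReal _ (hnonneg _)]
    rcases le_or_gt (g i) 0 with hg | hg
    · exact hg.trans (add_nonneg (r i).2 (hnonneg _))
    have hex : ∃ k : ℕ, B * (1 / 2) ^ k < g i := by
      obtain ⟨k, hk⟩ := exists_pow_lt_of_lt_one (div_pos hg hpos) (show (1 / 2 : ℝ) < 1 by norm_num)
      exact ⟨k, by rw [lt_div_iff₀ hpos] at hk; linarith⟩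
    classical
    obtain ⟨k, hk⟩ : ∃ k, Nat.find hex = k + 1 := by
      refine Nat.exists_eq_succ_of_ne_zero fun h => ?_
      have := Nat.find_spec hex
      rw [h] at this
      simp only [pow_zero, mul_one] at this
      linarith [hB i]
    have h1 : g i ≤ B * (1 / 2) ^ k := not_lt.1 (Nat.find_min hex (by omega))
    have h2 : B * (1 / 2) ^ (k + 1) < g i := hk ▸ Nat.find_spec hex
    have h3 : d (k + 1) < r i := not_le.1 fun h => absurd (hd (k + 1) i h) (not_le.2 h2)
    have h4 : F k (r i) = B * (1 / 2) ^ k := by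
      have : (1 : ℝ) ≤ r i / d (k + 1) := by
        rw [one_le_div (by exact_mod_cast hd0 (k + 1))]
        exact_mod_cast h3.le
      simp only [F, min_eq_left this, mul_one]
    have h5 : F k (r i) ≤ ∑' j, F j (r i) :=
      (hsum (r i)).le_tsum k fun j _ => hF0 j (r i)
    linarith [(r i).2, show (0 : ℝ) ≤ r i from (r i).2]

/-- In a finite family of `N` nonnegative numbers with sum at most `K`, one is at most `K / N`. -/
theorem exists_lt_le_div_of_sum_le {N : ℕ} (hN : 0 < N) {a : ℕ → ℝ} {K : ℝ}
    (h : ∑ t ∈ Finset.range N, a t ≤ K) : ∃ t < N, a t ≤ K / N := by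
  by_contra! hcon
  have hNR : (0 : ℝ) < N := by exact_mod_cast hN
  have := Finset.sum_lt_sum_of_nonempty (s := Finset.range N) (by simpa using hN.ne')
    (f := fun _ => K / N) fun t ht => hcon t (Finset.mem_range.1 ht)
  rw [Finset.sum_const, Finset.card_range, nsmul_eq_mul, mul_div_cancel₀ _ hNR.ne'] at this
  linarith

/-- A Lyapunov function sandwiched between class `𝒦` functions gives a class `𝒦ℒ` bound. -/
theorem exists_classKL_of_lyapunov {α ω : ℝ≥0 → ℝ≥0} (hα : ClassKInf α) (hω : ClassK ω) :
    ∃ β, ClassKL β ∧ ∀ (r : ℕ → ℝ≥0) (W : ℕ → ℝ), (∀ t, (α (r t) : ℝ) ≤ W t) →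
      (∀ t, W t ≤ ω (r t)) → (∀ t, W (t + 1) ≤ W t - α (r t)) → ∀ t : ℕ, r t ≤ β (r 0) t := by
  obtain ⟨γ, hγ, hγα⟩ := hα.exists_inverse
  -- Among the times 0, …, t some s has α(r s) ≤ ω(r 0)/(t + 1), since these terms sum to at most W
  -- 0. As W is nonincreasing, α(r t) ≤ W t ≤ W s ≤ ω(r s); inverting α twice gives this formula.
  refine ⟨fun r t => γ (ω (γ (ω r / (t + 1)))), ⟨fun t => ?_, fun r hr => ?_⟩, ?_⟩
  · refine hγ.comp (hω.comp (hγ.comp ⟨hω.1.div_const _, fun a b hab => ?_, by simp [hω.2.2]⟩))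
    have := hω.2.1 hab
    show ω a / (t + 1) < ω b / (t + 1)
    gcongr
  · have : 0 < ω r := by simpa [hω.2.2] using hω.2.1 hr
    exact hγ.comp_classL (hω.comp_classL (hγ.comp_classL (classL_div_add_one this)))
  · intro r W hlow hup hdec t
    have hanti : Antitone W := antitone_nat_of_succ_le fun k =>
      (hdec k).trans (sub_le_self _ (α (r k)).2)
    have hsum : ∀ k, ∑ s ∈ Finset.range k, (α (r s) : ℝ) ≤ W 0 - W k := by
      intro k
      induction k with
      | zero => simp
      | succ k ih => rw [Finset.sum_range_succ]; linarith [hdec k]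
    have hWnn : 0 ≤ W (t + 1) := (α (r (t + 1))).2.trans (hlow (t + 1))
    obtain ⟨s, hs, hsle⟩ := exists_lt_le_div_of_sum_le (Nat.succ_pos t)
      (((hsum (t + 1)).trans (sub_le_self _ hWnn)).trans (hup 0))
    have h1 : r s ≤ γ (ω (r 0) / (t + 1)) := by
      rw [← hγα]
      have : (α (r s) : ℝ) ≤ ((ω (r 0) / (t + 1) : ℝ≥0) : ℝ) := by
        push_cast at hsle ⊢
        exact hsle
      exact_mod_cast this
    rw [← hγα]
    have h2 : (α (r t) : ℝ) ≤ ω (r s) :=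
      ((hlow t).trans (hanti (Nat.lt_succ_iff.1 hs))).trans (hup s)
    have h3 : α (r t) ≤ ω (r s) := by exact_mod_cast h2
    exact h3.trans (hω.2.1.monotone h1)

namespace TubeMPC

variable {n m q : ℕ} (S : TubeMPC n m q)

/-! ### Concatenation of trajectories -/

theorem traj_add (z : Eu n) (v : ℕ → Eu m) (P t : ℕ) :
    S.traj z v (P + t) = S.traj (S.traj z v P) (fun k => v (P + k)) t := by
  induction t with
  | zero => rfl
  | succ t ih => rw [← add_assoc, traj, ih, traj]

theorem J_add (ℓ : Eu n → Eu m → ℝ) (P K : ℕ) (z : Eu n) (v : ℕ → Eu m) :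
    S.J ℓ (P + K) z v = S.J ℓ P z v + S.J ℓ K (S.traj z v P) (fun k => v (P + k)) := by
  simp only [J, Finset.sum_range_add, traj_add]

theorem adm_add {P K : ℕ} {z : Eu n} {v : ℕ → Eu m} :
    S.Adm (P + K) z v ↔ S.Adm P z v ∧ S.Adm K (S.traj z v P) (fun k => v (P + k)) := by
  refine ⟨fun h => ⟨fun t ht => h t (by omega), fun t ht => ?_⟩, fun h t ht => ?_⟩
  · rw [← traj_add]
    exact h (P + t) (by omega)
  · rcases lt_or_ge t P with htP | htP
    · exact h.1 t htP
    · obtain ⟨k, rfl⟩ := Nat.exists_eq_add_of_le htP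
      rw [traj_add]
      exact h.2 k (by omega)

theorem traj_congr {z : Eu n} {v v' : ℕ → Eu m} {T : ℕ} (h : ∀ t < T, v t = v' t) :
    S.traj z v T = S.traj z v' T := by
  induction T with
  | zero => rfl
  | succ T ih => rw [traj, traj, ih fun t ht => h t (by omega), h T (by omega)]

theorem J_congr {ℓ : Eu n → Eu m → ℝ} {z : Eu n} {v v' : ℕ → Eu m} {T : ℕ}
    (h : ∀ t < T, v t = v' t) : S.J ℓ T z v = S.J ℓ T z v' := by
  refine Finset.sum_congr rfl fun t ht => ?_
  rw [Finset.mem_range] at ht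
  rw [S.traj_congr fun s hs => h s (hs.trans ht), h t ht]

theorem adm_congr {z : Eu n} {v v' : ℕ → Eu m} {T : ℕ} (h : ∀ t < T, v t = v' t)
    (hv : S.Adm T z v) : S.Adm T z v' := by
  intro t ht
  rw [← S.traj_congr fun s hs => h s (hs.trans ht), ← h t ht]
  exact hv t ht

/-- Any two input sequences can be concatenated. -/
theorem exists_concat (v u : ℕ → Eu m) (P : ℕ) :
    ∃ w : ℕ → Eu m, (∀ t < P, v t = w t) ∧ (fun k => w (P + k)) = u :=
  ⟨fun t => if t < P then v t else u (t - P), fun t ht => by simp [ht], by ext; simp⟩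

theorem J_normalized (ℓ : Eu n → Eu m → ℝ) (T : ℕ) (z : Eu n) (v : ℕ → Eu m) :
    S.J (S.normalized ℓ) T z v = S.J ℓ T z v - T * ℓ S.zs S.vs := by
  simp [J, normalized, Finset.sum_sub_distrib]

theorem traj_steady (h : S.fπ S.zs S.vs 0 = S.zs) (t : ℕ) :
    S.traj S.zs (fun _ => S.vs) t = S.zs := by
  induction t with
  | zero => rfl
  | succ t ih => rw [traj, ih, h]

theorem nnnorm_sub_le_pairDist (z z' : Eu n) (v v' : Eu m) :
    ‖z - z'‖₊ ≤ pairDist z v z' v' := by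
  rw [← NNReal.coe_le_coe, pairDist, coe_nnnorm, coe_nnnorm, WithLp.prod_norm_eq_of_L2]
  exact Real.le_sqrt_of_sq_le (by simp)

theorem nnnorm_sub_snd_le_pairDist (z z' : Eu n) (v v' : Eu m) :
    ‖v - v'‖₊ ≤ pairDist z v z' v' := by
  rw [← NNReal.coe_le_coe, pairDist, coe_nnnorm, coe_nnnorm, WithLp.prod_norm_eq_of_L2]
  exact Real.le_sqrt_of_sq_le (by simp)

/-- The dissipation inequality on the tightened constraint set. -/
def Dissipative (ℓ : Eu n → Eu m → ℝ) (α : ℝ≥0 → ℝ≥0) (lam : Eu n → ℝ) : Prop :=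
  ∀ z v, (z, v) ∈ S.Zbar →
    lam (S.fπ z v 0) - lam z ≤ ℓ z v - ℓ S.zs S.vs - α (pairDist z v S.zs S.vs)

/-! ### Dissipation along trajectories. -/

variable {S} {ℓ : Eu n → Eu m → ℝ} {κ : ℝ} {vN : ℕ → Eu n → ℕ → Eu m} {z0 : ℕ → Eu n → Eu n}
  {α : ℝ≥0 → ℝ≥0} {lam : Eu n → ℝ}

theorem Dissipative.sum_le (hd : S.Dissipative ℓ α lam) {T : ℕ} {z : Eu n} {v : ℕ → Eu m}
    (hv : S.Adm T z v) :
    lam (S.traj z v T) + ∑ t ∈ Finset.range T, (α (pairDist (S.traj z v t) (v t) S.zs S.vs) : ℝ) ≤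
      lam z + S.J (S.normalized ℓ) T z v := by
  induction T with
  | zero => simp [J, traj]
  | succ T ih =>
    have h1 := ih fun t ht => hv t (by omega)
    have h2 := hd _ _ (hv T (by omega))
    simp only [J, Finset.sum_range_succ, traj, normalized] at h1 h2 ⊢
    linarith

theorem Dissipative.sub_le_J (hd : S.Dissipative ℓ α lam) {T : ℕ} {z : Eu n} {v : ℕ → Eu m}
    (hv : S.Adm T z v) : lam (S.traj z v T) - lam z ≤ S.J (S.normalized ℓ) T z v := by
  have h1 := hd.sum_le hv
  have h2 : 0 ≤ ∑ t ∈ Finset.range T, (α (pairDist (S.traj z v t) (v t) S.zs S.vs) : ℝ) :=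
    Finset.sum_nonneg fun t _ => NNReal.coe_nonneg _
  linarith

/-- A trajectory with bounded accumulated dissipation converges to the steady state. -/
theorem tendsto_traj_of_sum_le (hα : ClassKInf α) {z : Eu n} {v : ℕ → Eu m} {K : ℝ}
    (hK : ∀ T, ∑ t ∈ Finset.range T, (α (pairDist (S.traj z v t) (v t) S.zs S.vs) : ℝ) ≤ K) :
    Tendsto (S.traj z v) atTop (𝓝 S.zs) := by
  obtain ⟨γ, hγ, hγα⟩ := hα.exists_inverse
  have hs := (summable_of_sum_range_le (fun t => NNReal.coe_nonneg _) hK).tendsto_atTop_zero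
  have hs' : Tendsto (fun t => α (pairDist (S.traj z v t) (v t) S.zs S.vs)) atTop (𝓝 0) := by
    rw [← NNReal.tendsto_coe]
    exact hs
  have h1 : Tendsto (fun t => γ (α (pairDist (S.traj z v t) (v t) S.zs S.vs))) atTop (𝓝 0) := by
    have := (hγ.1.tendsto 0).comp hs'
    rwa [hγ.2.2] at this
  rw [tendsto_iff_norm_sub_tendsto_zero]
  have h2 : Tendsto (fun t => ‖S.traj z v t - S.zs‖₊) atTop (𝓝 0) :=
    tendsto_of_tendsto_of_tendsto_of_le_of_le tendsto_const_nhds h1 (fun t => zero_le) fun t =>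
      (nnnorm_sub_le_pairDist _ _ _ _).trans ((hγα _ _).1 le_rfl)
  rw [← NNReal.tendsto_coe] at h2
  exact h2

/-! ### Consequences of the standing assumptions -/

namespace Standing

variable (h : S.Standing ℓ κ vN z0)
include h

theorem exists_norm_sub_le : ∃ R : ℝ≥0, 0 < R ∧ ∀ z v, (z, v) ∈ S.Zbar → ‖z - S.zs‖₊ ≤ R := by
  obtain ⟨R, hR⟩ := h.Z_compact.isBounded.exists_norm_le
  have hz : ∀ z v, (z, v) ∈ S.Zbar → ‖z‖ ≤ R := fun z v hzv =>
    (norm_fst_le _).trans (hR _ (h.Zbar_subset hzv))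
  refine ⟨(R + R + 1).toNNReal, ?_, fun z v hzv => ?_⟩
  · have := (norm_nonneg _).trans (hz _ _ (interior_subset h.steady_interior))
    exact Real.toNNReal_pos.2 (by linarith)
  · apply NNReal.le_toNNReal_of_coe_le
    rw [coe_nnnorm]
    linarith [norm_sub_le z S.zs, hz z v hzv, hz _ _ (interior_subset h.steady_interior)]

theorem V_le {N : ℕ} (hN : 1 ≤ N) {z : Eu n} {v : ℕ → Eu m} (hv : S.FeasN N z v) :
    S.V ℓ N z ≤ S.Jf ℓ N z v := by
  have := (h.input_min N hN z ⟨v, hv⟩).2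
  exact csInf_le ⟨_, by rintro _ ⟨u, hu, rfl⟩; exact this u hu⟩ ⟨v, hv, rfl⟩

theorem V_eq {N : ℕ} (hN : 1 ≤ N) {z : Eu n} (hz : z ∈ S.XN N) :
    S.V ℓ N z = S.Jf ℓ N z (vN N z) := by
  have := h.input_min N hN z hz
  refine le_antisymm (h.V_le hN this.1) (le_csInf ⟨_, _, this.1, rfl⟩ ?_)
  rintro _ ⟨u, hu, rfl⟩
  exact this.2 u hu

/-- From a terminal state the system can be kept in the terminal region at a cost bounded by the
decrease of the terminal cost. -/
theorem exists_terminal_input {y : Eu n} (hy : y ∈ S.Xf) :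
    ∃ u, S.AdmInf y u ∧ (∀ t, S.traj y u t ∈ S.Xf) ∧
      ∀ t, S.J (S.normalized ℓ) t y u ≤ S.Vf y - S.Vf (S.traj y u t) := by
  obtain ⟨-, -, -, κf, hκ⟩ := h.terminal
  let s : ℕ → Eu n := fun t => (fun z => S.fπ z (κf z) 0)^[t] y
  have hs : ∀ t, S.traj y (fun t => κf (s t)) t = s t := by
    intro t
    induction t with
    | zero => rfl
    | succ t ih => rw [traj, ih]; exact (Function.iterate_succ_apply' (fun z => S.fπ z (κf z) 0) t y).symm
  have hX : ∀ t, s t ∈ S.Xf := by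
    intro t
    induction t with
    | zero => exact hy
    | succ t ih =>
      have := (hκ _ ih).2.1
      rwa [← Function.iterate_succ_apply' (fun z => S.fπ z (κf z) 0) t y] at this
  refine ⟨fun t => κf (s t), fun t => ?_, fun t => hs t ▸ hX t, fun t => ?_⟩
  · rw [hs]
    exact (hκ _ (hX t)).1
  · induction t with
    | zero => simp [J, traj]
    | succ t ih =>
      have h1 := (hκ _ (hX t)).2.2
      simp only [J, Finset.sum_range_succ, traj, normalized, hs] at ih h1 ⊢
      linarith

/-- The terminal region is compact: it is closed, and `κf` places each of its points in the bounded
state projection of the tightened constraints. -/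
theorem exists_abs_Vf_le : ∃ C, ∀ y ∈ S.Xf, |S.Vf y| ≤ C := by
  obtain ⟨R, -, hR⟩ := h.exists_norm_sub_le
  obtain ⟨hcl, -, hcont, κf, hκ⟩ := h.terminal
  have hb : Bornology.IsBounded S.Xf :=
    (Metric.isBounded_iff_subset_closedBall S.zs).2 ⟨R, fun y hy => by
      rw [mem_closedBall_iff_norm]
      exact_mod_cast hR _ _ (hκ y hy).1⟩
  exact (Metric.isCompact_of_isClosed_isBounded hcl hb).exists_bound_of_continuousOn hcont

theorem continuousAt_Vf : ContinuousAt S.Vf S.zs :=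
  h.terminal.2.2.1.continuousAt (mem_interior_iff_mem_nhds.1 h.terminal.2.1)

/-- By local controllability, the storage function is continuous at `z_s`. -/
theorem continuousAt_storage (hd : S.Dissipative ℓ α lam) : ContinuousAt lam S.zs := by
  obtain ⟨M, hM⟩ := h.controllable
  rw [Metric.continuousAt_iff']
  intro ε hε
  obtain ⟨r, hr, hball⟩ := Metric.nhds_basis_closedBall.mem_iff.1
    (mem_interior_iff_mem_nhds.1 h.steady_interior)
  have hκ := h.κ_pos
  -- The first bound keeps the connecting trajectory in `S.Zbar`, the second keeps its cost below
  -- ε/2; M + 1 instead of M avoids dividing by zero when M = 0.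
  set e := min r (ε / (2 * (M + 1) * κ)) with he
  have he0 : 0 < e := by positivity
  obtain ⟨δ, hδ, hc⟩ := hM e he0
  have hzs : (S.zs, S.vs) ∈ S.Zbar := interior_subset h.steady_interior
  -- The storage difference is at most the cost of steering y to y', which is small. Exchanging the
  -- roles of y and z_s gives both signs.
  have key : ∀ y y', ‖y - S.zs‖ ≤ δ → ‖y' - S.zs‖ ≤ δ → lam y' - lam y < ε := by
    intro y y' hy hy'
    obtain ⟨v, hv, hvd⟩ := hc y y' hy hy'
    have hadm : S.Adm M y v := by
      intro t ht
      apply hball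
      have h1 : (‖S.traj y v t - S.zs‖₊ : ℝ) ≤ _ := nnnorm_sub_le_pairDist _ S.zs (v t) S.vs
      have h2 : (‖v t - S.vs‖₊ : ℝ) ≤ _ := nnnorm_sub_snd_le_pairDist (S.traj y v t) S.zs _ _
      have h3 := (hvd t ht).trans (min_le_left _ _)
      rw [mem_closedBall_iff_norm, Prod.mk_sub_mk, Prod.norm_mk]
      exact max_le (h1.trans h3) (h2.trans h3)
    have h1 := hd.sub_le_J hadm
    rw [hv] at h1
    have h2 : S.J (S.normalized ℓ) M y v ≤ M * (κ * e) := by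
      have : ∀ t ∈ Finset.range M, S.normalized ℓ (S.traj y v t) (v t) ≤ κ * e := by
        intro t ht
        rw [Finset.mem_range] at ht
        have h3 := h.lipschitz _ (h.Zbar_subset (hadm t ht)) _ (h.Zbar_subset hzs)
        exact ((le_abs_self _).trans h3).trans (by gcongr; exact hvd t ht)
      simpa [J] using Finset.sum_le_sum this
    have h3 : (M + 1) * (κ * e) ≤ ε / 2 := by
      calc (M + 1) * (κ * e) ≤ (M + 1) * (κ * (ε / (2 * (M + 1) * κ))) := by
            gcongr; exact min_le_right _ _
        _ = ε / 2 := by field_simp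
    have : 0 ≤ κ * e := by positivity
    linarith
  filter_upwards [Metric.closedBall_mem_nhds S.zs hδ] with y hy
  rw [mem_closedBall_iff_norm] at hy
  rw [Real.dist_eq, abs_lt]
  have h0 : ‖S.zs - S.zs‖ ≤ δ := by simpa using hδ.le
  exact ⟨by linarith [key _ _ hy h0], by linarith [key _ _ h0 hy]⟩

/-! ### Rotated costs and the value at the steady state. -/

variable (hα : ClassKInf α) {C : ℝ} (hC : ∀ z, |lam z| ≤ C) (hd : S.Dissipative ℓ α lam)
include hα hC hd

theorem tendsto_terminal {y : Eu n} {u : ℕ → Eu m} (hu : S.AdmInf y u)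
    (huX : ∀ t, S.traj y u t ∈ S.Xf)
    (hJ : ∀ t, S.J (S.normalized ℓ) t y u ≤ S.Vf y - S.Vf (S.traj y u t)) :
    Tendsto (S.traj y u) atTop (𝓝 S.zs) := by
  obtain ⟨D, hD⟩ := h.exists_abs_Vf_le
  refine tendsto_traj_of_sum_le hα (K := C + C + D + D) fun T => ?_
  have h1 := hd.sum_le (T := T) fun t _ => hu t
  have h2 := abs_le.1 (hC y)
  have h3 := abs_le.1 (hC (S.traj y u T))
  have h4 := abs_le.1 (hD _ (huX 0))
  have h5 := abs_le.1 (hD _ (huX T))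
  simp only [traj] at h4
  linarith [hJ T]

/-- The rotated terminal cost is minimal at the steady state. -/
theorem rotated_terminal_min {y : Eu n} (hy : y ∈ S.Xf) :
    S.Vf S.zs + lam S.zs ≤ S.Vf y + lam y := by
  obtain ⟨u, hu, huX, hJ⟩ := h.exists_terminal_input hy
  have ht := h.tendsto_terminal hα hC hd hu huX hJ
  -- Under the terminal feedback the sum of terminal cost and storage never exceeds its initial
  -- value, and the trajectory tends to z_s, where both functions are continuous.
  refine le_of_tendsto ((h.continuousAt_Vf.tendsto.comp ht).add
    ((h.continuousAt_storage hd).tendsto.comp ht)) (Eventually.of_forall fun t => ?_)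
  have h1 := hd.sub_le_J (T := t) fun k _ => hu k
  simp only [Function.comp]
  linarith [hJ t]

theorem rotated_value_ge {N : ℕ} (hN : 1 ≤ N) {z : Eu n} (hz : z ∈ S.XN N) :
    N * ℓ S.zs S.vs + S.Vf S.zs + lam S.zs +
      ∑ t ∈ Finset.range N, (α (pairDist (S.traj z (vN N z) t) (vN N z t) S.zs S.vs) : ℝ) ≤
      S.V ℓ N z + lam z := by
  have hf := (h.input_min N hN z hz).1
  have h1 := hd.sum_le hf.1
  have h2 := h.rotated_terminal_min hα hC hd hf.2
  rw [h.V_eq hN hz, Jf]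
  rw [J_normalized] at h1
  linarith

/-- Staying at z_s gives the upper bound; the rotated lower bound shows that nothing is cheaper. -/
theorem V_steady {N : ℕ} (hN : 1 ≤ N) : S.V ℓ N S.zs = N * ℓ S.zs S.vs + S.Vf S.zs := by
  have hf : S.FeasN N S.zs fun _ => S.vs := by
    refine ⟨fun t _ => ?_, ?_⟩
    · rw [S.traj_steady h.steady]
      exact interior_subset h.steady_interior
    · rw [S.traj_steady h.steady]
      exact interior_subset h.terminal.2.1
  have h1 := h.V_le hN hf
  have h2 := h.rotated_value_ge hα hC hd hN ⟨_, hf⟩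
  have h3 : 0 ≤ ∑ t ∈ Finset.range N,
      (α (pairDist (S.traj S.zs (vN N S.zs) t) (vN N S.zs t) S.zs S.vs) : ℝ) :=
    Finset.sum_nonneg fun t _ => NNReal.coe_nonneg _
  simp only [Jf, J, S.traj_steady h.steady, Finset.sum_const, Finset.card_range,
    nsmul_eq_mul] at h1
  linarith

end Standing

end TubeMPC

/-! ### Shifting, turnpike estimate and infinite-horizon value. -/

namespace TubeMPC

variable {n m q : ℕ} {S : TubeMPC n m q}
  {ℓ : Eu n → Eu m → ℝ} {κ : ℝ} {vN : ℕ → Eu n → ℕ → Eu m} {z0 : ℕ → Eu n → Eu n}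
  {α : ℝ≥0 → ℝ≥0} {lam : Eu n → ℝ}

/-- A lower bound on the cost of all finite trajectories, with an error that vanishes at the steady
state, passes to the infinite-horizon value. -/
theorem Dissipative.le_VInf (hd : S.Dissipative ℓ α lam) (hα : ClassKInf α) {C : ℝ}
    (hC : ∀ z, |lam z| ≤ C) {ω : ℝ≥0 → ℝ≥0} (hω : ClassK ω) {b d : ℝ} (hd0 : 0 ≤ d) {z : Eu n}
    (hb : ∀ T, ∀ v, S.Adm T z v →
      b ≤ S.J (S.normalized ℓ) T z v + d + ω ‖S.traj z v T - S.zs‖₊) :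
    ((b - d : ℝ) : EReal) ≤ S.VInf (S.normalized ℓ) z := by
  refine le_iInf₂ fun v hv => ?_
  -- If the cost reaches b infinitely often, the limsup is at least b. Otherwise it is eventually
  -- below b, so the dissipation is summable, the trajectory converges to z_s and the ω-error
  -- disappears in the limit.
  by_cases hfr : ∃ᶠ T in atTop, b ≤ S.J (S.normalized ℓ) T z v
  · refine le_limsup_of_frequently_le (hfr.mono fun T hT => ?_)
    exact_mod_cast by linarith
  rw [not_frequently, eventually_atTop] at hfr
  obtain ⟨T₀, hT₀⟩ := hfr
  have ht : Tendsto (S.traj z v) atTop (𝓝 S.zs) := by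
    refine tendsto_traj_of_sum_le hα (K := b + C + C) fun T => ?_
    have h1 := hd.sum_le (T := T + T₀) fun t _ => hv t
    have h2 := abs_le.1 (hC z)
    have h3 := abs_le.1 (hC (S.traj z v (T + T₀)))
    have h4 := not_le.1 (hT₀ (T + T₀) (Nat.le_add_left _ _))
    refine (Finset.sum_le_sum_of_subset_of_nonneg (Finset.range_subset_range.2
      (Nat.le_add_right T T₀)) fun t _ _ => NNReal.coe_nonneg _).trans ?_
    linarith
  have hω0 : Tendsto (fun T => (ω ‖S.traj z v T - S.zs‖₊ : ℝ)) atTop (𝓝 0) := by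
    have h1 : Tendsto (fun T => ‖S.traj z v T - S.zs‖₊) atTop (𝓝 0) := by
      have := (ht.sub_const S.zs).nnnorm
      simpa using this
    have := (hω.1.tendsto 0).comp h1
    rw [hω.2.2] at this
    exact NNReal.tendsto_coe.2 this
  have hlim : Tendsto (fun T => ((b - d - ω ‖S.traj z v T - S.zs‖₊ : ℝ) : EReal)) atTop
      (𝓝 ((b - d : ℝ) : EReal)) := by
    refine (continuous_coe_real_ereal.tendsto _).comp ?_
    simpa using (tendsto_const_nhds (x := b - d)).sub hω0
  rw [← hlim.limsup_eq]
  refine limsup_le_limsup (Eventually.of_forall fun T => ?_)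
  have := hb T v fun t _ => hv t
  exact EReal.coe_le_coe (by linarith)

namespace Standing

variable (h : S.Standing ℓ κ vN z0)
include h

/-- An admissible sequence ending in the terminal region extends to an infinite one that stays
there, at a cost bounded by the decrease of the terminal cost. -/
theorem exists_extension {P : ℕ} {z : Eu n} {v : ℕ → Eu m} (hv : S.FeasN P z v) :
    ∃ w, (∀ t < P, v t = w t) ∧ S.AdmInf z w ∧ ∀ K, S.traj z w (P + K) ∈ S.Xf ∧
      S.J (S.normalized ℓ) (P + K) z w + S.Vf (S.traj z w (P + K)) ≤
        S.J (S.normalized ℓ) P z v + S.Vf (S.traj z v P) := by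
  obtain ⟨u, hu, huX, hJ⟩ := h.exists_terminal_input hv.2
  obtain ⟨w, hw, hwu⟩ := exists_concat v u P
  have htr : S.traj z w P = S.traj z v P := (S.traj_congr hw).symm
  refine ⟨w, hw, fun t => ?_, fun K => ?_⟩
  · have : S.Adm (P + (t + 1)) z w :=
      S.adm_add.2 ⟨S.adm_congr hw hv.1, by rw [hwu, htr]; exact fun k _ => hu k⟩
    exact this t (by omega)
  · rw [S.traj_add, S.J_add, hwu, htr, ← S.J_congr hw]
    exact ⟨huX K, by linarith [hJ K]⟩

/-- Shifting the optimal input sequence and appending a terminal input. -/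
theorem exists_shift {N : ℕ} (hN : 1 ≤ N) {z : Eu n} (hz : z ∈ S.XN N) :
    ∃ u, S.FeasN N (S.fπ z (vN N z 0) 0) u ∧
      S.Jf ℓ N (S.fπ z (vN N z 0) 0) u ≤ S.V ℓ N z - S.normalized ℓ z (vN N z 0) := by
  obtain ⟨w, hw, hwa, hwX⟩ := h.exists_extension (h.input_min N hN z hz).1
  obtain ⟨hX, hJ⟩ := hwX 1
  have h1 : S.traj z w 1 = S.fπ z (vN N z 0) 0 := by rw [traj, traj, hw 0 hN]
  have hadm : S.Adm (1 + N) z w := fun t _ => hwa t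
  rw [← h1]
  refine ⟨fun k => w (1 + k), ⟨(S.adm_add.1 hadm).2, ?_⟩, ?_⟩
  · rw [← S.traj_add, add_comm]
    exact hX
  · rw [h.V_eq hN hz, Jf, Jf, ← S.traj_add]
    rw [add_comm N 1, S.J_add] at hJ
    have h2 : S.J (S.normalized ℓ) 1 z w = S.normalized ℓ z (vN N z 0) := by
      simp [J, traj, hw 0 hN]
    rw [h2, J_normalized, J_normalized] at hJ
    linarith

/-- The nominal successor is itself a candidate initial state in the tube around the next real
state, so the selected minimizer has no larger value, and the shifted sequence bounds the value of
the successor. -/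
theorem zcl_mem_and_V_le {N : ℕ} (hN : 1 ≤ N) {z zcl : Eu n} (hz : z ∈ S.XN N)
    (hcl : zcl ∈ S.Zcl vN z0 N z) :
    zcl ∈ S.XN N ∧ S.V ℓ N zcl ≤ S.V ℓ N z - S.normalized ℓ z (vN N z 0) := by
  obtain ⟨u, hu, hJ⟩ := h.exists_shift hN hz
  obtain ⟨x, hx, rfl⟩ := hcl
  have hF : S.fπ z (vN N z 0) 0 ∈ S.XN N := ⟨u, hu⟩
  have hs := h.state_min N hN x (Set.add_subset_add_right (Set.singleton_subset_iff.2 hF) hx)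
  exact ⟨hs.1.1, (hs.2 _ hF hx).trans ((h.V_le hN hu).trans hJ)⟩

theorem closedLoop_mem {N : ℕ} (hN : 1 ≤ N) {ζ : ℕ → Eu n}
    (hζ : S.IsNominalClosedLoop vN z0 N ζ) (t : ℕ) : ζ t ∈ S.XN N := by
  induction t with
  | zero => exact hζ.1
  | succ t ih => exact (h.zcl_mem_and_V_le hN ih (hζ.2 t)).1

theorem nomCost_normalized_le {N : ℕ} (hN : 1 ≤ N) {ζ : ℕ → Eu n}
    (hζ : S.IsNominalClosedLoop vN z0 N ζ) (T : ℕ) :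
    nomCost (S.normalized ℓ) vN N ζ T ≤ S.V ℓ N (ζ 0) - S.V ℓ N (ζ T) := by
  induction T with
  | zero => simp [nomCost]
  | succ T ih =>
    have := (h.zcl_mem_and_V_le hN (h.closedLoop_mem hN hζ T) (hζ.2 T)).2
    rw [nomCost] at ih ⊢
    rw [Finset.sum_range_succ]
    linarith

theorem exists_XN_bound : ∃ R : ℝ≥0, 0 < R ∧ ∀ N, 1 ≤ N → ∀ z ∈ S.XN N, ‖z - S.zs‖₊ ≤ R := by
  obtain ⟨R, hR0, hR⟩ := h.exists_norm_sub_le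
  refine ⟨R, hR0, fun N hN z hz => ?_⟩
  obtain ⟨v, hv, -⟩ := hz
  exact hR _ _ (hv 0 hN)

theorem exists_V_bound : ∃ B : ℝ, 0 ≤ B ∧ ∀ N, 1 ≤ N → ∀ z ∈ S.XN N,
    S.V ℓ N z - S.V ℓ N S.zs ≤ B := by
  obtain ⟨R, -, hR⟩ := h.exists_XN_bound
  obtain ⟨αV, hαV, hV⟩ := h.value_cont
  refine ⟨αV R, NNReal.coe_nonneg _, fun N hN z hz => ?_⟩
  refine ((le_abs_self _).trans (hV N hN z hz)).trans ?_
  exact_mod_cast hαV.1.2.1.monotone (hR N hN z hz)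

variable (hα : ClassKInf α) {C : ℝ} (hC : ∀ z, |lam z| ≤ C) (hd : S.Dissipative ℓ α lam)
include hα hC hd

/-- Over any initial piece of the horizon, an admissible sequence is at most cheaper than the
optimal value by a function of the distance of its end point to the steady state. -/
theorem exists_value_le_J_add :
    ∃ ω, ClassKInf ω ∧ (∀ y, |lam y - lam S.zs| ≤ ω ‖y - S.zs‖₊) ∧
      ∀ N, 1 ≤ N → ∀ z ∈ S.XN N, ∀ P ≤ N, ∀ v, S.Adm P z v →
        S.V ℓ N z - S.V ℓ N S.zs ≤ S.J (S.normalized ℓ) P z v + ω ‖S.traj z v P - S.zs‖₊ := by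
  classical
  obtain ⟨B, hB0, hB⟩ := h.exists_V_bound
  obtain ⟨D, hD⟩ := h.exists_abs_Vf_le
  have hC0 : 0 ≤ C := (abs_nonneg _).trans (hC S.zs)
  have hzX : S.zs ∈ S.Xf := interior_subset h.terminal.2.1
  have hlam : ∀ y, |lam y - lam S.zs| ≤ 2 * C := fun y => by
    linarith [abs_sub (lam y) (lam S.zs), hC y, hC S.zs]
  -- End points in 𝕏_f need the oscillation of terminal cost and storage around z_s. Elsewhere `B +
  -- 2 * C` suffices, as the value excess is at most B and any cost is at least -2C. Smallness near
  -- z_s concerns only the first case, z_s being interior to 𝕏_f.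
  obtain ⟨ω, hω, hg⟩ := exists_classKInf_majorant (fun y : Eu n => ‖y - S.zs‖₊)
    (fun y => if y ∈ S.Xf then max |lam y - lam S.zs| |S.Vf y - S.Vf S.zs| else B + 2 * C)
    (max (B + 2 * C) (2 * D)) (fun y => by
      split_ifs with hy
      · refine max_le (le_max_of_le_left (by linarith [hlam y])) (le_max_of_le_right ?_)
        linarith [abs_sub (S.Vf y) (S.Vf S.zs), hD y hy, hD _ hzX]
      · exact le_max_left _ _) (fun ε hε => by
      have h1 := Metric.continuousAt_iff'.1 (h.continuousAt_storage hd) ε hε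
      have h2 := Metric.continuousAt_iff'.1 h.continuousAt_Vf ε hε
      have h3 := mem_interior_iff_mem_nhds.1 h.terminal.2.1
      obtain ⟨δ, hδ, hsub⟩ := Metric.nhds_basis_closedBall.mem_iff.1 (h1.and (h2.and h3))
      refine ⟨⟨δ, hδ.le⟩, hδ, fun y hy => ?_⟩
      have hy' : y ∈ Metric.closedBall S.zs δ := by
        rw [mem_closedBall_iff_norm]
        exact hy
      obtain ⟨ha, hb, hc⟩ := hsub hy'
      have hc : y ∈ S.Xf := hc
      rw [if_pos hc]
      exact max_le ha.le hb.le)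
  refine ⟨ω, hω, fun y => ?_, fun N hN z hz P hP v hv => ?_⟩
  · refine le_trans ?_ (hg y)
    split_ifs
    · exact le_max_left _ _
    · linarith [hlam y]
  · have hgy := hg (S.traj z v P)
    by_cases hy : S.traj z v P ∈ S.Xf
    · rw [if_pos hy] at hgy
      have h0 := (le_abs_self _).trans ((le_max_right _ _).trans hgy)
      -- The terminal feedback fills the remaining N - P steps, producing a competitor for `S.V ℓ N
      -- z`.
      obtain ⟨w, hw, hwa, hwX⟩ := h.exists_extension ⟨hv, hy⟩
      obtain ⟨K, rfl⟩ := Nat.exists_eq_add_of_le hP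
      have h1 := h.V_le hN ⟨fun t _ => hwa t, (hwX K).1⟩
      have h2 := (hwX K).2
      rw [J_normalized] at h2
      rw [h.V_steady hα hC hd hN]
      rw [Jf] at h1
      linarith
    · rw [if_neg hy] at hgy
      have h1 := hd.sub_le_J hv
      have h2 := abs_le.1 (hC z)
      have h3 := abs_le.1 (hC (S.traj z v P))
      linarith [hB N hN z hz]

/-- By the turnpike property the previous bound holds over every horizon `T`, up to an error that
vanishes as the prediction horizon grows. -/
theorem exists_value_le_J_add_turnpike :
    ∃ ω δ, ClassKInf ω ∧ ClassL δ ∧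
      ∀ N : ℕ, 1 ≤ N → ∀ z ∈ S.XN N, ∀ T, ∀ v, S.Adm T z v →
        S.V ℓ N z - S.V ℓ N S.zs ≤
          S.J (S.normalized ℓ) T z v + δ N + ω ‖S.traj z v T - S.zs‖₊ := by
  obtain ⟨ω, hω, hlam, hA⟩ := h.exists_value_le_J_add hα hC hd
  obtain ⟨B, hB0, hB⟩ := h.exists_V_bound
  obtain ⟨γ, hγ, hγα⟩ := hα.exists_inverse
  have hC0 : 0 ≤ C := (abs_nonneg _).trans (hC S.zs)
  -- K bounds the total dissipation of a sequence cheaper than the value excess; the extra 1 makes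
  -- it positive. Below, K/N is replaced by 2K/(N + 1), which dominates it for N ≥ 1 and is of class
  -- ℒ.
  set K : ℝ≥0 := (B + 2 * C + 1).toNNReal with hKdef
  have hK : (K : ℝ) = B + 2 * C + 1 := Real.coe_toNNReal _ (by linarith)
  have hK0 : 0 < 2 * K := by
    rw [← NNReal.coe_pos]
    push_cast
    linarith
  have hδ := hω.1.comp_classL (hγ.comp_classL (classL_div_add_one hK0))
  -- The error at the turnpike time P enters twice: once from comparing the value with the cost up
  -- to P, once from the storage at P bounding the remaining cost.
  refine ⟨ω, _, hω, hδ.add hδ, fun N hN z hz T v hv => ?_⟩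
  rcases le_or_gt T N with hT | hT
  · have h1 := hA N hN z hz T hT v hv
    have := NNReal.coe_nonneg (ω (γ (2 * K / (N + 1))) + ω (γ (2 * K / (N + 1))))
    linarith
  rcases le_or_gt (S.V ℓ N z - S.V ℓ N S.zs) (S.J (S.normalized ℓ) T z v) with hJ | hJ
  · have := NNReal.coe_nonneg (ω (γ (2 * K / (N + 1))) + ω (γ (2 * K / (N + 1))))
    have := NNReal.coe_nonneg (ω ‖S.traj z v T - S.zs‖₊)
    linarith
  have hsum : ∑ t ∈ Finset.range N, (α (pairDist (S.traj z v t) (v t) S.zs S.vs) : ℝ) ≤ K := by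
    have h1 := hd.sum_le hv
    have h2 := abs_le.1 (hC z)
    have h3 := abs_le.1 (hC (S.traj z v T))
    refine (Finset.sum_le_sum_of_subset_of_nonneg
      (Finset.range_subset_range.2 hT.le) fun t _ _ => NNReal.coe_nonneg _).trans ?_
    linarith [hB N hN z hz]
  obtain ⟨P, hPN, hP⟩ := exists_lt_le_div_of_sum_le hN hsum
  have hdist : ‖S.traj z v P - S.zs‖₊ ≤ γ (2 * K / (N + 1)) := by
    refine (nnnorm_sub_le_pairDist _ _ (v P) S.vs).trans ((hγα _ _).1 ?_)
    rw [← NNReal.coe_le_coe]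
    refine hP.trans ?_
    have hNR : (1 : ℝ) ≤ N := by exact_mod_cast hN
    push_cast
    rw [div_le_div_iff₀ (by linarith) (by linarith)]
    nlinarith [K.2, show (0 : ℝ) ≤ K from K.2]
  obtain ⟨k, rfl⟩ := Nat.exists_eq_add_of_le (hPN.trans hT).le
  obtain ⟨hv1, hv2⟩ := S.adm_add.1 hv
  have h1 := hA N hN z hz P hPN.le v hv1
  have h2 := hd.sub_le_J hv2
  have h3 := abs_le.1 (hlam (S.traj z v P))
  have h4 := abs_le.1 (hlam (S.traj z v (P + k)))
  have h5 : (ω ‖S.traj z v P - S.zs‖₊ : ℝ) ≤ ω (γ (2 * K / (N + 1))) := by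
    exact_mod_cast hω.1.2.1.monotone hdist
  rw [← S.traj_add] at h2
  rw [S.J_add]
  push_cast
  linarith

/-- The optimal sequence, continued by the terminal feedback, is an infinite competitor. Its cost
plus the current terminal cost never exceeds the normalized optimal objective, and the terminal cost
tends to V_f(z_s). -/
theorem VInf_le {N : ℕ} (hN : 1 ≤ N) {z : Eu n} (hz : z ∈ S.XN N) :
    S.VInf (S.normalized ℓ) z ≤ ((S.V ℓ N z - S.V ℓ N S.zs : ℝ) : EReal) := by
  have hf := (h.input_min N hN z hz).1
  obtain ⟨w, hw, hwa, hwX⟩ := h.exists_extension hf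
  obtain ⟨D, hD⟩ := h.exists_abs_Vf_le
  have hV : S.V ℓ N z - S.V ℓ N S.zs =
      S.J (S.normalized ℓ) N z (vN N z) + S.Vf (S.traj z (vN N z) N) - S.Vf S.zs := by
    rw [h.V_eq hN hz, h.V_steady hα hC hd hN, Jf, J_normalized]
    ring
  rw [hV]
  set a := S.J (S.normalized ℓ) N z (vN N z) + S.Vf (S.traj z (vN N z) N) with ha
  have ht : Tendsto (S.traj z w) atTop (𝓝 S.zs) := by
    refine tendsto_traj_of_sum_le hα (K := a + D + C + C) fun T => ?_
    have h1 := hd.sum_le (T := N + T) fun t _ => hwa t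
    have h2 := abs_le.1 (hC z)
    have h3 := abs_le.1 (hC (S.traj z w (N + T)))
    have h4 := abs_le.1 (hD _ (hwX T).1)
    refine (Finset.sum_le_sum_of_subset_of_nonneg (Finset.range_subset_range.2
      (Nat.le_add_left T N)) fun t _ _ => NNReal.coe_nonneg _).trans ?_
    linarith [(hwX T).2]
  have hlim : Tendsto (fun T => ((a - S.Vf (S.traj z w T) : ℝ) : EReal)) atTop
      (𝓝 ((a - S.Vf S.zs : ℝ) : EReal)) :=
    (continuous_coe_real_ereal.tendsto _).comp
      (tendsto_const_nhds.sub (h.continuousAt_Vf.tendsto.comp ht))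
  refine (iInf₂_le w hwa).trans ?_
  rw [← hlim.limsup_eq]
  refine limsup_le_limsup ?_
  filter_upwards [eventually_ge_atTop N] with T hT
  obtain ⟨K, rfl⟩ := Nat.exists_eq_add_of_le hT
  exact_mod_cast by linarith [(hwX K).2]

end Standing

end TubeMPC

namespace TubeMPC

variable {n m q : ℕ} {S : TubeMPC n m q}
  {ℓ : Eu n → Eu m → ℝ} {κ : ℝ} {vN : ℕ → Eu n → ℕ → Eu m} {z0 : ℕ → Eu n → Eu n}
  {α : ℝ≥0 → ℝ≥0} {lam : Eu n → ℝ}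

/-! ### The nominal closed loop -/

theorem nomCost_normalized (ℓ : Eu n → Eu m → ℝ) (N : ℕ) (ζ : ℕ → Eu n) (T : ℕ) :
    nomCost (S.normalized ℓ) vN N ζ T = nomCost ℓ vN N ζ T - T * ℓ S.zs S.vs := by
  simp [nomCost, normalized, Finset.sum_sub_distrib]

namespace Standing

/-- The rotated optimal value is a Lyapunov function of the nominal closed loop, uniformly in the
horizon. -/
theorem exists_convergenceBound (h : S.Standing ℓ κ vN z0) :
    ∃ β, ClassKL β ∧ S.ConvergenceBound vN z0 β := by
  obtain ⟨α, lam, hα, ⟨C, hC⟩, hd, hcl⟩ := h.dissipativity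
  obtain ⟨ω, hω, hlam, -⟩ := h.exists_value_le_J_add hα hC hd
  obtain ⟨αV, hαV, hV⟩ := h.value_cont
  have hsum : ClassK fun r => αV r + ω r :=
    ⟨hαV.1.1.add hω.1.1, hαV.1.2.1.add hω.1.2.1, by simp [hαV.1.2.2, hω.1.2.2]⟩
  obtain ⟨β, hβ, hβb⟩ := exists_classKL_of_lyapunov hα hsum
  refine ⟨β, hβ, fun N hN ζ hζ => ?_⟩
  have hX := h.closedLoop_mem hN hζ
  have hαle : ∀ z v, (α ‖z - S.zs‖₊ : ℝ) ≤ α (pairDist z v S.zs S.vs) := fun z v =>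
    NNReal.coe_le_coe.2 (hα.1.2.1.monotone (nnnorm_sub_le_pairDist z S.zs v S.vs))
  refine hβb (fun t => ‖ζ t - S.zs‖₊)
    (fun t => S.V ℓ N (ζ t) - S.V ℓ N S.zs + (lam (ζ t) - lam S.zs))
    (fun t => ?_) (fun t => ?_) (fun t => ?_)
  · have h1 := h.rotated_value_ge hα hC hd hN (hX t)
    rw [h.V_steady hα hC hd hN]
    have h2 := Finset.single_le_sum
      (f := fun k => (α (pairDist (S.traj (ζ t) (vN N (ζ t)) k) (vN N (ζ t) k) S.zs S.vs) : ℝ))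
      (fun k _ => NNReal.coe_nonneg _) (Finset.mem_range.2 (show 0 < N from hN))
    have h3 := hαle (ζ t) (vN N (ζ t) 0)
    simp only [traj] at h2
    linarith
  · have h1 := (le_abs_self _).trans (hV N hN _ (hX t))
    have h2 := (le_abs_self _).trans (hlam (ζ t))
    push_cast
    linarith
  · have h1 := (h.zcl_mem_and_V_le hN (hX t) (hζ.2 t)).2
    -- The next nominal state need not be the nominal successor, so the dissipation inequality along
    -- closed-loop sequences is needed here.
    have h2 := hcl N hN _ (hX t) _ (hζ.2 t)
    have h3 := hαle (ζ t) (vN N (ζ t) 0)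
    rw [normalized] at h1
    linarith

/-- Transient and infinite-horizon performance of the nominal closed loop. -/
theorem exists_nominalBounds (h : S.Standing ℓ κ vN z0) {β : ℝ≥0 → ℝ≥0 → ℝ≥0}
    (hβ : ClassKL β) (hb : S.ConvergenceBound vN z0 β) :
    ∃ δ₁ δ₂, ClassL δ₁ ∧ ClassL δ₂ ∧ S.NominalBounds ℓ vN z0 β δ₁ δ₂ ∧
      ∀ N : ℕ, 1 ≤ N → ∀ ζ, S.IsNominalClosedLoop vN z0 N ζ → ∀ T : ℕ,
        (nomCost (S.normalized ℓ) vN N ζ T : EReal) ≤ S.VInf (S.normalized ℓ) (ζ 0) -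
          S.VInf (S.normalized ℓ) (ζ T) + (δ₁ N : ℝ) := by
  obtain ⟨α, lam, hα, ⟨C, hC⟩, hd, -⟩ := h.dissipativity
  obtain ⟨ω, δ, hω, hδ, hB⟩ := h.exists_value_le_J_add_turnpike hα hC hd
  obtain ⟨αV, hαV, hV⟩ := h.value_cont
  obtain ⟨R, hR0, hR⟩ := h.exists_XN_bound
  have hβR := hβ.2 R hR0
  have hlow : ∀ N : ℕ, 1 ≤ N → ∀ z ∈ S.XN N,
      ((S.V ℓ N z - S.V ℓ N S.zs - δ N : ℝ) : EReal) ≤ S.VInf (S.normalized ℓ) z :=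
    fun N hN z hz => Dissipative.le_VInf hd hα hC hω.1 (NNReal.coe_nonneg _) (hB N hN z hz)
  have hup := fun N hN z hz => h.VInf_le hα hC hd (N := N) hN (z := z) hz
  have hrad : ∀ N, 1 ≤ N → ∀ z ∈ S.XN N, ∀ T : ℕ, S.radius β z T ≤ β R T :=
    fun N hN z hz T => (hβ.1 T).2.1.monotone (hR N hN z hz)
  have hcost : ∀ N, 1 ≤ N → ∀ ζ, S.IsNominalClosedLoop vN z0 N ζ → ∀ T : ℕ,
      nomCost (S.normalized ℓ) vN N ζ T ≤ S.V ℓ N (ζ 0) - S.V ℓ N S.zs + αV (β R T) := by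
    intro N hN ζ hζ T
    have h1 := h.nomCost_normalized_le hN hζ T
    have h2 := (abs_le.1 (hV N hN _ (h.closedLoop_mem hN hζ T))).1
    have h3 : (αV ‖ζ T - S.zs‖₊ : ℝ) ≤ αV (β R T) := by
      exact_mod_cast hαV.1.2.1.monotone ((hb N hN ζ hζ T).trans (hrad N hN _ hζ.1 T))
    linarith
  -- The ω-term covers the end point of a competitor, the αV-term that of the closed loop. Both lie
  -- within β(R, T), where R bounds all feasible distances, so the error depends on T alone.
  have hδ₂ := (hω.1.comp_classL hβR).add (hαV.1.comp_classL hβR)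
  refine ⟨δ, _, hδ, hδ₂, fun N hN ζ hζ => ⟨fun T => ?_, ?_⟩, fun N hN ζ hζ T => ?_⟩
  · have h1 := hcost N hN ζ hζ T
    rw [nomCost_normalized] at h1
    -- The errors are subtracted on the left so that the bound passes to the infimum, which may be
    -- +∞.
    have h3 : ((nomCost ℓ vN N ζ T - δ N - (ω (β R T) + αV (β R T)) : ℝ) : EReal) ≤
        S.bestTransient ℓ β T (ζ 0) := by
      refine le_iInf₂ fun v hv => EReal.coe_le_coe ?_
      have h4 := hB N hN _ hζ.1 T v hv.1
      rw [J_normalized] at h4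
      have h5 : (ω ‖S.traj (ζ 0) v T - S.zs‖₊ : ℝ) ≤ ω (β R T) := by
        have : ‖S.traj (ζ 0) v T - S.zs‖₊ ≤ S.radius β (ζ 0) T := hv.2
        exact_mod_cast hω.1.2.1.monotone (this.trans (hrad N hN _ hζ.1 T))
      linarith
    calc (nomCost ℓ vN N ζ T : EReal)
        = ((nomCost ℓ vN N ζ T - δ N - (ω (β R T) + αV (β R T)) : ℝ) : EReal) + (δ N : ℝ) +
            (((ω (β R T) + αV (β R T) : ℝ≥0) : ℝ) : EReal) := by
          rw [← EReal.coe_add, ← EReal.coe_add]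
          congr 1
          push_cast
          ring
      _ ≤ _ := by gcongr
  · have hlim : Tendsto (fun T : ℕ =>
        ((S.V ℓ N (ζ 0) - S.V ℓ N S.zs + αV (β R T) : ℝ) : EReal)) atTop
        (𝓝 ((S.V ℓ N (ζ 0) - S.V ℓ N S.zs : ℝ) : EReal)) := by
      refine (continuous_coe_real_ereal.tendsto _).comp ?_
      have h1 := (hαV.1.comp_classL hβR).2.2.comp tendsto_natCast_atTop_atTop
      simpa using (tendsto_const_nhds (x := S.V ℓ N (ζ 0) - S.V ℓ N S.zs)).add
        (NNReal.tendsto_coe.2 h1)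
    calc limsup (fun T => (nomCost (S.normalized ℓ) vN N ζ T : EReal)) atTop
        ≤ ((S.V ℓ N (ζ 0) - S.V ℓ N S.zs : ℝ) : EReal) := by
          rw [← hlim.limsup_eq]
          exact limsup_le_limsup (Eventually.of_forall fun T =>
            EReal.coe_le_coe (hcost N hN ζ hζ T))
      _ = ((S.V ℓ N (ζ 0) - S.V ℓ N S.zs - δ N : ℝ) : EReal) + (δ N : ℝ) := by
          rw [← EReal.coe_add, sub_add_cancel]
      _ ≤ _ := by gcongr; exact hlow N hN _ hζ.1
  · have hfin : ∀ z ∈ S.XN N, ∃ a : ℝ, S.VInf (S.normalized ℓ) z = a := fun z hz => by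
      have h1 := hlow N hN z hz
      have h2 := hup N hN z hz
      exact ⟨_, (EReal.coe_toReal (h2.trans_lt (EReal.coe_lt_top _)).ne
        ((EReal.bot_lt_coe _).trans_le h1).ne').symm⟩
    have hT := h.closedLoop_mem hN hζ T
    obtain ⟨a, ha⟩ := hfin _ hζ.1
    obtain ⟨b, hb⟩ := hfin _ hT
    have h1 := hlow N hN _ hζ.1
    have h2 := hup N hN _ hT
    have h3 := h.nomCost_normalized_le hN hζ T
    rw [ha] at h1 ⊢
    rw [hb] at h2 ⊢
    rw [EReal.coe_le_coe_iff] at h1 h2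
    rw [← EReal.coe_sub, ← EReal.coe_add, EReal.coe_le_coe_iff]
    linarith

/-! ### The real closed loop -/

theorem mem_add_of_real (h : S.Standing ℓ κ vN z0) {N : ℕ} (hN : 1 ≤ N) {x : Eu n}
    (hx : x ∈ S.XN N + S.Ω) :
    x - z0 N x ∈ S.Ω ∧ z0 N x ∈ S.XN N ∧ (z0 N x, vN N (z0 N x) 0) ∈ S.Zbar ∧
      (x, vN N (z0 N x) 0) ∈ S.Zπ := by
  obtain ⟨⟨hz, hxz⟩, -⟩ := h.state_min N hN x hx
  rw [Set.singleton_add] at hxz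
  obtain ⟨ε, hε, hεx⟩ := hxz
  have hx' : z0 N x + ε = x := hεx
  have hv : (z0 N x, vN N (z0 N x) 0) ∈ S.Zbar := (h.input_min N hN _ hz).1.1 0 hN
  refine ⟨by rwa [sub_eq_iff_eq_add'.2 hx'.symm], hz, hv, ?_⟩
  have := hv ε hε
  simpa only [hx'] using this

/-- The nominal states selected along a real closed-loop trajectory. -/
theorem nominal_of_real (h : S.Standing ℓ κ vN z0) {N : ℕ} (hN : 1 ≤ N) {x : ℕ → Eu n}
    (hx : S.IsRealClosedLoop vN z0 N x) :
    (∀ t, x t ∈ S.XN N + S.Ω) ∧ S.IsNominalClosedLoop vN z0 N fun t => z0 N (x t) := by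
  obtain ⟨hx0, w, hw, hstep⟩ := hx
  have hkey : ∀ t, x t ∈ S.XN N + S.Ω →
      x (t + 1) ∈ {S.fπ (z0 N (x t)) (vN N (z0 N (x t)) 0) 0} + S.Ω ∧
      x (t + 1) ∈ S.XN N + S.Ω := by
    intro t ht
    obtain ⟨h1, h2, -, h4⟩ := h.mem_add_of_real hN ht
    -- Invariance keeps the next real state in the tube around the nominal successor, whatever the
    -- disturbance.
    have h5 := h.rci.2 _ _ _ h1 h4 (w t) (hw t)
    have h6 : S.fπ (x t) (vN N (z0 N (x t)) 0) (w t) = x (t + 1) := (hstep t).symm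
    rw [h6] at h5
    have h7 : x (t + 1) ∈ {S.fπ (z0 N (x t)) (vN N (z0 N (x t)) 0) 0} + S.Ω := by
      rw [Set.singleton_add]
      exact ⟨_, h5, add_sub_cancel _ _⟩
    refine ⟨h7, Set.add_subset_add_right (Set.singleton_subset_iff.2 ?_) h7⟩
    obtain ⟨u, hu, -⟩ := h.exists_shift hN h2
    exact ⟨u, hu⟩
  have hmem : ∀ t, x t ∈ S.XN N + S.Ω := fun t => by
    induction t with
    | zero => exact hx0
    | succ t ih => exact (hkey t ih).2
  exact ⟨hmem, (h.mem_add_of_real hN hx0).2.1, fun t => ⟨_, (hkey t (hmem t)).1, rfl⟩⟩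

end Standing

end TubeMPC

/-! ### Comparison of real and nominal costs. -/

namespace TubeMPC

variable {n m q : ℕ} {S : TubeMPC n m q}
  {κ : ℝ} {vN : ℕ → Eu n → ℕ → Eu m} {z0 : ℕ → Eu n → Eu n}

/-- The worst-case cost of the nominal state bounds the cost of the real state. -/
theorem Lπ_le_Lmax (hZ : IsCompact S.Z) (hL : Continuous fun p : Eu n × Eu m => S.L p.1 p.2)
    {x z : Eu n} {v : Eu m} (hzv : (z, v) ∈ S.Zbar) (hx : x - z ∈ S.Ω) :
    S.Lπ x v ≤ S.Lmax z v := by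
  refine le_csSup ?_ ⟨x - z, hx, by simp⟩
  refine (hZ.image hL).bddAbove.mono ?_
  rintro _ ⟨ε, hε, rfl⟩
  exact ⟨_, hzv ε hε, rfl⟩

theorem realCost_sub_const (c : Eu n → Eu m → ℝ) (a : ℝ) (N : ℕ) (x : ℕ → Eu n) (T : ℕ) :
    realCost (fun y v => c y v - a) vN z0 N x T = realCost c vN z0 N x T - T * a := by
  simp [realCost, Finset.sum_sub_distrib]

theorem realCost_le_nomCost_of_Lmax (h : S.Standing S.Lmax κ vN z0) {N : ℕ} (hN : 1 ≤ N)
    {x : ℕ → Eu n} (hx : S.IsRealClosedLoop vN z0 N x) (T : ℕ) :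
    realCost S.Lπ vN z0 N x T ≤ nomCost S.Lmax vN N (fun t => z0 N (x t)) T := by
  refine Finset.sum_le_sum fun t _ => ?_
  obtain ⟨h1, -, h3, -⟩ := h.mem_add_of_real hN ((h.nominal_of_real hN hx).1 t)
  exact Lπ_le_Lmax h.Z_compact h.L_cont h3 h1

theorem realCost_le_nomCost_of_Lπ (h : S.Standing S.Lπ κ vN z0) {N : ℕ} (hN : 1 ≤ N)
    {x : ℕ → Eu n} (hx : S.IsRealClosedLoop vN z0 N x) (T : ℕ) :
    realCost S.Lπ vN z0 N x T ≤
      nomCost S.Lπ vN N (fun t => z0 N (x t)) T + T * κ * sSup (norm '' S.Ω) := by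
  have hstep : ∀ t ∈ Finset.range T, S.Lπ (x t) (vN N (z0 N (x t)) 0) ≤
      S.Lπ (z0 N (x t)) (vN N (z0 N (x t)) 0) + κ * sSup (norm '' S.Ω) := by
    intro t _
    obtain ⟨h1, -, h3, h4⟩ := h.mem_add_of_real hN ((h.nominal_of_real hN hx).1 t)
    have h5 := (le_abs_self _).trans (h.lipschitz _ h4 _ (h.Zbar_subset h3))
    -- Real and nominal pairs share the same artificial input, so their distance is that of the
    -- states alone.
    have h6 : (pairDist (x t) (vN N (z0 N (x t)) 0) (z0 N (x t)) (vN N (z0 N (x t)) 0) : ℝ) =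
        ‖x t - z0 N (x t)‖ := by
      rw [pairDist, coe_nnnorm, WithLp.prod_norm_eq_of_L2]
      simp
    have h7 : ‖x t - z0 N (x t)‖ ≤ sSup (norm '' S.Ω) :=
      le_csSup (h.rci.1.image continuous_norm).bddAbove ⟨_, h1, rfl⟩
    have h8 := mul_le_mul_of_nonneg_left (h6.le.trans h7) h.κ_pos.le
    dsimp only at h5
    linarith
  have := Finset.sum_le_sum hstep
  rw [Finset.sum_add_distrib, Finset.sum_const, Finset.card_range, nsmul_eq_mul] at this
  rw [mul_assoc]
  exact this

end TubeMPC

end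

theorem mainTheorem6 {n m q : ℕ} (S : TubeMPC n m q) (κ : ℝ)
    (vN : ℕ → Eu n → ℕ → Eu m) (z0 : ℕ → Eu n → Eu n) :
    -- worst-case stage cost
    (S.Standing S.Lmax κ vN z0 →
      (∃ β, ClassKL β ∧ S.ConvergenceBound vN z0 β) ∧
      ∀ β, ClassKL β → S.ConvergenceBound vN z0 β →
        ∃ δ₁ δ₂, ClassL δ₁ ∧ ClassL δ₂ ∧ S.NominalBounds S.Lmax vN z0 β δ₁ δ₂ ∧
          ∀ N : ℕ, 1 ≤ N → ∀ x, S.IsRealClosedLoop vN z0 N x →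
            (∀ T : ℕ, (TubeMPC.realCost S.Lπ vN z0 N x T : EReal) ≤
              S.bestTransient S.Lmax β T (z0 N (x 0)) + (δ₁ N : ℝ) + (δ₂ T : ℝ)) ∧
            limsup (fun T => (TubeMPC.realCost (fun y v => S.Lπ y v - S.Lmax S.zs S.vs)
                vN z0 N x T : EReal)) atTop ≤
              S.VInf (S.normalized S.Lmax) (z0 N (x 0)) + (δ₁ N : ℝ)) ∧
    -- nominal stage cost
    (S.Standing S.Lπ κ vN z0 →
      (∃ β, ClassKL β ∧ S.ConvergenceBound vN z0 β) ∧
      ∀ β, ClassKL β → S.ConvergenceBound vN z0 β →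
        ∃ δ₁ δ₂, ClassL δ₁ ∧ ClassL δ₂ ∧ S.NominalBounds S.Lπ vN z0 β δ₁ δ₂ ∧
          ∀ N : ℕ, 1 ≤ N → ∀ x, S.IsRealClosedLoop vN z0 N x → ∀ T : ℕ,
            (TubeMPC.realCost S.Lπ vN z0 N x T : EReal) ≤
              S.bestTransient S.Lπ β T (z0 N (x 0)) + (δ₁ N : ℝ) + (δ₂ T : ℝ) +
                ((T * κ * sSup (norm '' S.Ω) : ℝ) : EReal) ∧
            (TubeMPC.realCost (fun y v => S.Lπ y v - S.Lπ S.zs S.vs) vN z0 N x T : EReal) ≤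
              S.VInf (S.normalized S.Lπ) (z0 N (x 0)) -
                S.VInf (S.normalized S.Lπ) (z0 N (x T)) + (δ₁ N : ℝ) +
                ((T * κ * sSup (norm '' S.Ω) : ℝ) : EReal)) := by
  refine ⟨fun h => ⟨h.exists_convergenceBound, fun β hβ hb => ?_⟩,
    fun h => ⟨h.exists_convergenceBound, fun β hβ hb => ?_⟩⟩
  · obtain ⟨δ₁, δ₂, hδ₁, hδ₂, hnom, -⟩ := h.exists_nominalBounds hβ hb
    refine ⟨δ₁, δ₂, hδ₁, hδ₂, hnom, fun N hN x hx => ?_⟩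
    have hle := TubeMPC.realCost_le_nomCost_of_Lmax h hN hx
    obtain ⟨h1, h2⟩ := hnom N hN _ (h.nominal_of_real hN hx).2
    refine ⟨fun T => (EReal.coe_le_coe (hle T)).trans (h1 T), le_trans ?_ h2⟩
    refine limsup_le_limsup (Eventually.of_forall fun T => EReal.coe_le_coe ?_)
    rw [TubeMPC.realCost_sub_const, TubeMPC.nomCost_normalized]
    exact sub_le_sub_right (hle T) _
  · obtain ⟨δ₁, δ₂, hδ₁, hδ₂, hnom, hdiff⟩ := h.exists_nominalBounds hβ hb
    refine ⟨δ₁, δ₂, hδ₁, hδ₂, hnom, fun N hN x hx T => ?_⟩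
    have hle := TubeMPC.realCost_le_nomCost_of_Lπ h hN hx T
    have hζ := (h.nominal_of_real hN hx).2
    constructor
    · refine (EReal.coe_le_coe hle).trans ?_
      rw [EReal.coe_add]
      gcongr
      exact (hnom N hN _ hζ).1 T
    · have hle' : TubeMPC.realCost (fun y v => S.Lπ y v - S.Lπ S.zs S.vs) vN z0 N x T ≤
          TubeMPC.nomCost (S.normalized S.Lπ) vN N (fun t => z0 N (x t)) T +
            T * κ * sSup (norm '' S.Ω) := by
        rw [TubeMPC.realCost_sub_const, TubeMPC.nomCost_normalized]
        linarith
      refine (EReal.coe_le_coe hle').trans ?_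
      rw [EReal.coe_add]
      gcongr
      exact hdiff N hN _ hζ T
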